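/- Let $F\in\mathbb{Z}[x_1,\ldots,x_n]$ be an absolutely irreducible quartic form (homogeneous of degree $4$ and irreducible over $\overline{\mathbb{Q}}$), let $X\subset\mathbb{P}^{n-1}_{\mathbb{Q}}$ be the hypersurface $F=0$, and let $\sigma$ be the dimension of the singular locus of $X$ (the locus $F=\partial F/\partial x_1=\cdots=\partial F/\partial x_n=0$ in $\mathbb{P}^{n-1}_{\mathbb{Q}}$), with $\sigma=-1$ if $X$ is non-singular. Given real constants $c$ and $c_j$ $(j\ge 0)$, let $\mathcal{W}_n$ be the set of infinitely differentiable functions $w:\mathbb{R}^n\to\mathbb{R}_{\ge 0}$ that are supported in $[-c,c]^n$ and all of whose partial derivatives of order $j$ are bounded by $c_j$ in absolute value, for every $j\ge 0$; let $\chi$ be the characteristic function of $(0,1]^n$. For $\omega\in\mathcal{W}_n\cup\{\chi\}$, $P\ge 1$ and $\alpha\in\mathbb{R}$ put $$S(\alpha)=\sum_{\mathbf{x}\in\mathbb{Z}^n}\omega(\mathbf{x}/P)\,e^{2\pi i\alpha F(\mathbf{x})}.$$ Then for every $\varepsilon>0$ there is a constant $C>0$, depending only on $F$, $n$, $\varepsilon$,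 $c$ and the $c_j$, such that $$|S(a/q+z)|\le C\,P^{n+\varepsilon}\left(q|z|+q^{-1}|z|^{-1}P^{-4}\right)^{(n-\sigma-1)/24}$$ for all $\omega\in\mathcal{W}_n\cup\{\chi\}$, all real $P\ge 1$, all integers $a$ and $q\ge 1$ with $\gcd(a,q)=1$, and all real $z$ with $0<|z|\le q^{-2}$. -/

import Mathlib

noncomputable section

namespace QuarticWeyl

open MvPolynomial

attribute [local instance] MvPolynomial.gradedAlgebra

/-- The singular locus of the hypersurface `F = 0` in projective space `ℙ^{n-1}` over `ℚ`: the closed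
subset of `Proj ℚ[x₁,…,xₙ]` on which `F` and all its first partial derivatives vanish. -/
def singLocus {n : ℕ} (F : MvPolynomial (Fin n) ℤ) :
    Set (ProjectiveSpectrum (homogeneousSubmodule (Fin n) ℚ)) :=
  ProjectiveSpectrum.zeroLocus (homogeneousSubmodule (Fin n) ℚ)
    (insert (map (Int.castRingHom ℚ) F)
      (Set.range fun i : Fin n => pderiv i (map (Int.castRingHom ℚ) F)))

/-- `σ`, the dimension of the singular locus of the projective hypersurface `F = 0`, with the
convention that the empty set has dimension `-1`. (The dimension is always finite, being at most
that of the projective space, so that `toNat` loses nothing.) -/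
def sigma {n : ℕ} (F : MvPolynomial (Fin n) ℤ) : ℤ :=
  match topologicalKrullDim (singLocus F) with
  | ⊥ => -1
  | (d : ℕ∞) => (d.toNat : ℤ)

/-- The class `𝒲ₙ` of weights attached to constants `c` and `cⱼ` (`j ≥ 0`): the non-negative smooth
functions on `ℝⁿ` supported in `[-c, c]ⁿ`, all of whose partial derivatives of order `j`
`∂_{k₁} ⋯ ∂_{kⱼ} w` are bounded by `cⱼ` in absolute value, for every `j`. -/
def weightClass (n : ℕ) (c : ℝ) (cj : ℕ → ℝ) : Set ((Fin n → ℝ) → ℝ) :=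
  {w | ContDiff ℝ (⊤ : ℕ∞) w ∧
    (∀ x, 0 ≤ w x) ∧
    Function.support w ⊆ {x | ∀ i, |x i| ≤ c} ∧
    ∀ (j : ℕ) (k : Fin j → Fin n) (x : Fin n → ℝ),
      |iteratedFDeriv ℝ j w x (fun l => Pi.single (k l) (1 : ℝ))| ≤ cj j}

/-- The characteristic function of `(0,1]ⁿ`. -/
def boxWeight (n : ℕ) : (Fin n → ℝ) → ℝ :=
  Set.indicator {x | ∀ i, 0 < x i ∧ x i ≤ 1} (fun _ => 1)

/-- `S(α) = ∑_{x ∈ ℤⁿ} ω(x/P) e^{2πiαF(x)}`; for `P > 0` and `ω` of bounded support only finitely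
many terms are non-zero. -/
def expSum {n : ℕ} (F : MvPolynomial (Fin n) ℤ) (ω : (Fin n → ℝ) → ℝ) (P α : ℝ) : ℂ :=
  ∑' x : Fin n → ℤ, (ω (fun i => (x i : ℝ) / P) : ℂ) *
    Complex.exp (2 * Real.pi * Complex.I * α * ((eval x F : ℤ) : ℂ))

end QuarticWeyl

end

noncomputable section

namespace QuarticWeyl

open MvPolynomial

attribute [local instance] MvPolynomial.gradedAlgebra

/-! ### Hyperplane sections of closed subsets of projective space -/

/-! The proof is Weyl differencing followed by a Davenport-style shrinking argument and a geometric
count.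

Three differencing steps over a box turn the phase `αF` into one that is affine in the remaining
variable, with linear coefficients `αBᵢ(x, y, w)`. Here the `Bᵢ` are the symmetric trilinear forms
with `Bᵢ(x, x, x) = 6 ∂ᵢF` (`norm_wsum_pow_eight_le`, `diff_diff_diff_eval`). Summing the geometric
progressions bounds the eighth power of the sum, up to logarithms, by `P^{5n}` times the number of
`(x, y, w, m)` with `x, y, w ≪ P` and `|αB(x, y, w) + m| ≪ 1/P`.

With two variables fixed, these are the points of a lattice `(w, αB(x, y, w) + m)` in a box. The
matrix of `B(x, y, ·)` is symmetric, so the lattice is essentially self-dual, and shrinking the box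
by a factor `Z` costs only `(log / Z)^n` (`card_latSet_shrink`). That follows from a Fourier duality
inequality and log-convexity of the count, without successive minima. Shrinking each variable in
turn leaves variables of size `W` and tolerance of order `W³/P⁴`.

Put `T = q|z| + 1/(q|z|P⁴)` and let `W³T` be a small constant. Then the approximation `a/q` forces
`B(x, y, w) = 0` and `m = 0` (`eq_zero_of_near_int`). The common zeros of the `Bᵢ` in a box of size
`W` number `O(W^{2n+σ+1})` (`exists_card_trilinZeros_le`): `2n` linear forms cut out the diagonal,
where the `Bᵢ` become the gradient, and `σ+1` more cut the singular cone to the origin. Together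
these forms have uniformly finite fibres on the zero set. Hence the eighth power is at most about
`P^{8n} W^{-(n-σ-1)}`, and `W⁻¹ ≍ T^{1/3}` gives the exponent `1/24 = 1/(8·3)`.

All box bounds are uniform in the box, so smooth weights follow by summation by parts
(`norm_sum_mul_ee_le`). -/

/-- The linear form with integer coefficients `a`. -/
def linForm {n : ℕ} (a : Fin n → ℤ) : MvPolynomial (Fin n) ℚ := ∑ j, C (a j : ℚ) * X j

abbrev RatProj (n : ℕ) := ProjectiveSpectrum (homogeneousSubmodule (Fin n) ℚ)

def toPrime {n : ℕ} (x : RatProj n) : PrimeSpectrum (MvPolynomial (Fin n) ℚ) :=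
  ⟨x.asHomogeneousIdeal.toIdeal, x.isPrime⟩

/-- Closed sets on both sides are zero loci of subsets of the same ring. Noetherianity and the
dimension bound for Proj are inherited from Spec in this way. -/
lemma isInducing_toPrime (n : ℕ) : Topology.IsInducing (toPrime (n := n)) := by
  refine ⟨TopologicalSpace.ext_iff_isClosed.2 fun s => ?_⟩
  rw [isClosed_induced_iff, ProjectiveSpectrum.isClosed_iff_zeroLocus]
  constructor
  · rintro ⟨t, rfl⟩
    exact ⟨PrimeSpectrum.zeroLocus t, PrimeSpectrum.isClosed_zeroLocus t, rfl⟩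
  · rintro ⟨t, ht, rfl⟩
    obtain ⟨u, rfl⟩ := (PrimeSpectrum.isClosed_iff_zeroLocus t).1 ht
    exact ⟨u, rfl⟩

instance noetherianSpace_ratProj (n : ℕ) : TopologicalSpace.NoetherianSpace (RatProj n) :=
  (isInducing_toPrime n).noetherianSpace

lemma coe_decompose_eq {τ : Type*} (p : MvPolynomial τ ℚ) (d : ℕ) :
    (DirectSum.decompose (homogeneousSubmodule τ ℚ) p d : MvPolynomial τ ℚ) =
      homogeneousComponent d p :=
  MvPolynomial.decomposition.decompose'_apply p d

lemma constantCoeff_eq_zero_of_mem {n : ℕ} {I : Ideal (MvPolynomial (Fin n) ℚ)}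
    (hI : I.IsHomogeneous (homogeneousSubmodule (Fin n) ℚ)) (hne : I ≠ ⊤)
    {p : MvPolynomial (Fin n) ℚ} (hp : p ∈ I) : constantCoeff p = 0 := by
  by_contra h
  have h0 := hI 0 hp
  rw [coe_decompose_eq, homogeneousComponent_zero] at h0
  refine hne (I.eq_top_of_isUnit_mem h0 ?_)
  exact (isUnit_iff_ne_zero.2 h).map C

lemma exists_X_notMem {n : ℕ} (x : RatProj n) : ∃ j, X j ∉ x.asHomogeneousIdeal.toIdeal := by
  by_contra! h
  refine x.not_irrelevant_le ?_
  intro p hp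
  have hp0 : constantCoeff p = 0 := by
    have := (HomogeneousIdeal.mem_irrelevant_iff _ p).1 hp
    rw [GradedRing.proj_apply, coe_decompose_eq, homogeneousComponent_zero] at this
    rw [constantCoeff_eq]
    simpa using this
  have h1 : p ∈ Ideal.span (Set.range (X : Fin n → MvPolynomial (Fin n) ℚ)) := by
    rw [← Set.image_univ, mem_ideal_span_X_image]
    intro m hm
    by_contra! hm0
    have : m = 0 := Finsupp.ext fun i => hm0 i (Set.mem_univ i)
    rw [this] at hm
    exact (mem_support_iff.1 hm) hp0
  have h2 : Ideal.span (Set.range (X : Fin n → MvPolynomial (Fin n) ℚ)) ≤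
      x.asHomogeneousIdeal.toIdeal := Ideal.span_le.2 (by rintro _ ⟨j, rfl⟩; exact h j)
  exact h2 h1

/-- Prime avoidance with integer coefficients. Were there no such form, the subgroups of `ℤⁿ`
attached to the points would cover `ℤⁿ`, so one would have finite index. Then a nonzero multiple of
every variable would lie in that prime, which a point of Proj forbids. -/
lemma exists_linForm_notMem {n : ℕ} {s : Set (RatProj n)} (hs : s.Finite) :
    ∃ a : Fin n → ℤ, ∀ x ∈ s, linForm a ∉ x.asHomogeneousIdeal.toIdeal := by
  by_contra! h
  let H : RatProj n → Submodule ℤ (Fin n → ℤ) := fun x =>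
    { carrier := {a | linForm a ∈ x.asHomogeneousIdeal.toIdeal}
      add_mem' := by
        intro a b ha hb
        have : linForm (a + b) = linForm a + linForm b := by
          simp [linForm, ← Finset.sum_add_distrib, add_mul]
        simp only [Set.mem_ofPred_eq, this]
        exact Ideal.add_mem _ ha hb
      zero_mem' := by simp [linForm]
      smul_mem' := by
        intro c a ha
        have : linForm (c • a) = C (c : ℚ) * linForm a := by
          simp [linForm, Finset.mul_sum, mul_assoc]
        simp only [Set.mem_ofPred_eq, this]
        exact Ideal.mul_mem_left _ _ ha }
  obtain ⟨x, hx, hfi⟩ := Submodule.exists_finiteIndex_of_cover (p := H) (s := hs.toFinset) (by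
    refine Set.eq_univ_of_forall fun a => ?_
    obtain ⟨x, hx, hxa⟩ := h a
    exact Set.mem_biUnion (hs.mem_toFinset.2 hx) hxa)
  obtain ⟨j, hj⟩ := exists_X_notMem x
  refine hj ?_
  have h1 : (H x).toAddSubgroup.index • (Pi.single j 1 : Fin n → ℤ) ∈ (H x).toAddSubgroup :=
    AddSubgroup.nsmul_index_mem _ _
  set m := (H x).toAddSubgroup.index
  have hm : m ≠ 0 := hfi.index_ne_zero
  have h2 : linForm (m • (Pi.single j 1 : Fin n → ℤ)) ∈ x.asHomogeneousIdeal.toIdeal := h1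
  have h3 : linForm (m • (Pi.single j 1 : Fin n → ℤ)) = C (m : ℚ) * X j := by
    unfold linForm
    rw [Finset.sum_eq_single j]
    · simp
    · intro b _ hb
      simp [hb]
    · simp
  rw [h3] at h2
  have := Ideal.mul_mem_left _ (C ((m : ℚ)⁻¹)) h2
  rwa [← mul_assoc, ← C_mul, inv_mul_cancel₀ (by exact_mod_cast hm), C_1, one_mul] at this

open TopologicalSpace in
-- The form is chosen nonzero at one point of each irreducible component. A chain in the section
-- then has its top member properly inside a component of `Z`, so it becomes one step longer in `Z`.
lemma length_lt_of_inter_linForm {n k : ℕ} {Z : Set (RatProj n)}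
    (h : ∀ p : LTSeries (IrreducibleCloseds Z), p.length < k + 1) :
    ∃ a : Fin n → ℤ, ∀ p : LTSeries (IrreducibleCloseds
      ↥(Z ∩ ProjectiveSpectrum.zeroLocus (homogeneousSubmodule (Fin n) ℚ) {linForm a})),
      p.length < k := by
  have hfin : (irreducibleComponents Z).Finite :=
    NoetherianSpace.finite_irreducibleComponents
  have hne : ∀ T : irreducibleComponents Z, (T : Set Z).Nonempty := fun T => T.2.1.nonempty
  choose g hg using hne
  have := hfin.to_subtype
  obtain ⟨a, ha⟩ := exists_linForm_notMem (s := Set.range fun T => (g T : RatProj n))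
    (Set.finite_range _)
  refine ⟨a, ?_⟩
  set Z' := Z ∩ ProjectiveSpectrum.zeroLocus (homogeneousSubmodule (Fin n) ℚ) {linForm a}
  intro p
  let i : Z' → Z := Set.inclusion Set.inter_subset_left
  have hi : Topology.IsInducing i := (Topology.IsEmbedding.inclusion Set.inter_subset_left).isInducing
  let p' := p.map (IrreducibleCloseds.map i hi.continuous)
    (IrreducibleCloseds.map_strictMono_of_isInducing hi)
  have hW : IsClosed {z : Z | (z : RatProj n) ∈
      ProjectiveSpectrum.zeroLocus (homogeneousSubmodule (Fin n) ℚ) {linForm a}} :=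
    (ProjectiveSpectrum.isClosed_zeroLocus _ _).preimage continuous_subtype_val
  have hsub : (p'.last : Set Z) ⊆ {z : Z | (z : RatProj n) ∈
      ProjectiveSpectrum.zeroLocus (homogeneousSubmodule (Fin n) ℚ) {linForm a}} := by
    have : p'.last = IrreducibleCloseds.map i hi.continuous p.last := rfl
    rw [this, IrreducibleCloseds.coe_map]
    refine closure_minimal ?_ hW
    rintro _ ⟨z, _, rfl⟩
    exact z.2.2
  obtain ⟨T, hT, hTs⟩ := exists_mem_irreducibleComponents_subset_of_isIrreducible
    (p'.last : Set Z) p'.last.isIrreducible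
  have hTc : IsClosed T := isClosed_of_mem_irreducibleComponents T hT
  let T' : IrreducibleCloseds Z := ⟨T, hT.1, hTc⟩
  have hlt : p'.last < T' := by
    refine lt_of_le_of_ne hTs ?_
    intro he
    have h1 : g ⟨T, hT⟩ ∈ (p'.last : Set Z) := by rw [he]; exact hg ⟨T, hT⟩
    have h2 := hsub h1
    refine ha _ ⟨⟨T, hT⟩, rfl⟩ ?_
    exact h2 rfl
  have h1 : p.length + 1 < k + 1 := h (p'.snoc T' hlt)
  omega

open TopologicalSpace in
-- Bounding chain lengths strictly by `k` encodes dimension at most `k - 1`, with the empty set as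
-- the case `k = 0`. Each hyperplane section lowers `k` by one.
lemma exists_linForms {n : ℕ} (k : ℕ) : ∀ {Z : Set (RatProj n)}, IsClosed Z →
    (∀ p : LTSeries (IrreducibleCloseds Z), p.length < k) →
    ∃ a : Fin k → Fin n → ℤ, Z ∩ ProjectiveSpectrum.zeroLocus (homogeneousSubmodule (Fin n) ℚ)
      (Set.range fun i => linForm (a i)) = ∅ := by
  induction k with
  | zero =>
    intro Z hZ h
    refine ⟨Fin.elim0, ?_⟩
    by_contra hne
    obtain ⟨x, hx⟩ := Set.nonempty_iff_ne_empty.2 hne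
    let T : IrreducibleCloseds Z := ⟨closure {⟨x, hx.1⟩}, isIrreducible_singleton.closure,
      isClosed_closure⟩
    exact absurd (h (RelSeries.singleton _ T)) (Nat.not_lt_zero _)
  | succ k ih =>
    intro Z hZ h
    obtain ⟨a, ha⟩ := length_lt_of_inter_linForm h
    obtain ⟨b, hb⟩ := ih (hZ.inter (ProjectiveSpectrum.isClosed_zeroLocus _ _)) ha
    refine ⟨Fin.cons a b, ?_⟩
    rw [← hb, Set.inter_assoc, ← ProjectiveSpectrum.zeroLocus_union]
    congr 2
    ext f
    simp [Fin.exists_fin_succ, eq_comm]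

open TopologicalSpace in
-- Passing to affine cones, a chain in Proj gives a chain in the `n`-dimensional spectrum, and the
-- origin can be added below it because no point of Proj contains all the variables.
lemma length_lt_of_ratProj {n : ℕ} (p : LTSeries (IrreducibleCloseds (RatProj n))) :
    p.length < n := by
  have hdim : Order.krullDim (IrreducibleCloseds (PrimeSpectrum (MvPolynomial (Fin n) ℚ))) = n := by
    have h1 : topologicalKrullDim (PrimeSpectrum (MvPolynomial (Fin n) ℚ)) = _ :=
      PrimeSpectrum.topologicalKrullDim_eq_ringKrullDim _
    rw [MvPolynomial.ringKrullDim_of_isNoetherianRing] at h1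
    simpa [topologicalKrullDim] using h1
  let p' := p.map (IrreducibleCloseds.map _ (isInducing_toPrime n).continuous)
    (IrreducibleCloseds.map_strictMono_of_isInducing (isInducing_toPrime n))
  let m : PrimeSpectrum (MvPolynomial (Fin n) ℚ) :=
    ⟨RingHom.ker (constantCoeff : MvPolynomial (Fin n) ℚ →+* ℚ), RingHom.ker_isPrime _⟩
  have hle : ∀ x : RatProj n, toPrime x ≤ m := fun x p hp =>
    constantCoeff_eq_zero_of_mem x.asHomogeneousIdeal.isHomogeneous x.isPrime.ne_top hp
  let T : IrreducibleCloseds (PrimeSpectrum (MvPolynomial (Fin n) ℚ)) :=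
    ⟨closure {m}, isIrreducible_singleton.closure, isClosed_closure⟩
  obtain ⟨x, hx⟩ := p.head.isIrreducible.nonempty
  have hx' : toPrime x ∈ (p'.head : Set (PrimeSpectrum (MvPolynomial (Fin n) ℚ))) := by
    have : p'.head = IrreducibleCloseds.map _ (isInducing_toPrime n).continuous p.head := rfl
    rw [this, IrreducibleCloseds.coe_map]
    exact subset_closure ⟨x, hx, rfl⟩
  have hlt : T < p'.head := by
    refine lt_of_le_of_ne ?_ ?_
    · change closure {m} ⊆ (p'.head : Set (PrimeSpectrum (MvPolynomial (Fin n) ℚ)))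
      refine closure_minimal ?_ p'.head.isClosed
      rw [Set.singleton_subset_iff]
      have : m ∈ closure {toPrime x} :=
        (PrimeSpectrum.le_iff_mem_closure _ _).1 (hle x)
      exact closure_minimal (Set.singleton_subset_iff.2 hx') p'.head.isClosed this
    · intro he
      rw [← he] at hx'
      have h1 : m ≤ toPrime x := (PrimeSpectrum.le_iff_mem_closure _ _).2 hx'
      obtain ⟨j, hj⟩ := exists_X_notMem x
      refine hj (h1 ?_)
      change constantCoeff (X j) = 0
      simp
  have h1 := Order.LTSeries.length_le_krullDim (p'.cons T hlt)
  rw [hdim] at h1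
  have h2 : (p'.cons T hlt).length = p.length + 1 := by simp [RelSeries.cons_length]; rfl
  rw [h2] at h1
  exact_mod_cast h1

lemma exists_linForms_singLocus {n : ℕ} (F : MvPolynomial (Fin n) ℤ) :
    ∃ s : ℕ, (s : ℤ) = sigma F + 1 ∧ s ≤ n ∧ ∃ a : Fin s → Fin n → ℤ,
      singLocus F ∩ ProjectiveSpectrum.zeroLocus (homogeneousSubmodule (Fin n) ℚ)
      (Set.range fun i => linForm (a i)) = ∅ := by
  have hcl : IsClosed (singLocus F) := ProjectiveSpectrum.isClosed_zeroLocus _ _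
  have hlt : ∀ p : LTSeries (TopologicalSpace.IrreducibleCloseds (singLocus F)),
      p.length < n := fun p => length_lt_of_ratProj (p.map _
        (TopologicalSpace.IrreducibleCloseds.map_strictMono_of_isInducing
          Topology.IsInducing.subtypeVal))
  have hd := (Order.krullDim_lt_coe_iff (n := n)).2 hlt
  change topologicalKrullDim (singLocus F) < n at hd
  rcases hD : topologicalKrullDim (singLocus F) with _ | _ | d
  · refine ⟨0, ?_, n.zero_le, ?_⟩
    · have h0 : sigma F = -1 := by
        unfold sigma; rw [hD]
      rw [h0]; norm_num
    · refine exists_linForms 0 hcl ((Order.krullDim_lt_coe_iff (n := 0)).1 ?_)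
      change topologicalKrullDim (singLocus F) < _
      rw [hD]
      exact WithBot.bot_lt_coe _
  -- Infinite dimension is excluded by the bound `n`, so the `toNat` in `sigma` is harmless.
  · rw [hD] at hd
    exact absurd hd (not_lt_of_ge (WithBot.coe_le_coe.2 le_top : ((n : ℕ∞) : WithBot ℕ∞) ≤ ((⊤ : ℕ∞) : WithBot ℕ∞)))
  · rw [hD] at hd
    have hdn : d < n := by
      have : (((d : ℕ) : ℕ∞) : WithBot ℕ∞) < ((n : ℕ∞) : WithBot ℕ∞) := hd
      exact_mod_cast this
    refine ⟨d + 1, ?_, hdn, ?_⟩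
    · have h0 : sigma F = d := by
        unfold sigma; rw [hD]; rfl
      rw [h0]; rfl
    · refine exists_linForms (d + 1) hcl ((Order.krullDim_lt_coe_iff (n := d + 1)).1 ?_)
      change topologicalKrullDim (singLocus F) < _
      rw [hD]
      have : (((d : ℕ) : ℕ∞) : WithBot ℕ∞) < (((d + 1 : ℕ) : ℕ∞) : WithBot ℕ∞) := by
        exact_mod_cast Nat.lt_succ_self d
      exact this

lemma linForm_isHomogeneous {n : ℕ} (a : Fin n → ℤ) : (linForm a).IsHomogeneous 1 := by
  refine IsHomogeneous.sum _ _ _ fun j _ => ?_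
  simpa using (isHomogeneous_C (Fin n) (a j : ℚ)).mul (isHomogeneous_X ℚ j)

/-- Linear forms cutting the singular locus down to the empty set, in ideal-theoretic terms. -/
lemma exists_X_pow_mem {n : ℕ} {F : MvPolynomial (Fin n) ℤ} (hF : F.IsHomogeneous 4) :
    ∃ s : ℕ, (s : ℤ) = sigma F + 1 ∧ s ≤ n ∧ ∃ a : Fin s → Fin n → ℤ, ∃ N : ℕ, ∀ j : Fin n,
      (X j : MvPolynomial (Fin n) ℚ) ^ N ∈
        Ideal.span (Set.range fun i => pderiv i (map (Int.castRingHom ℚ) F)) ⊔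
        Ideal.span (Set.range fun i => linForm (a i)) := by
  obtain ⟨s, hs, hsn, a, ha⟩ := exists_linForms_singLocus F
  refine ⟨s, hs, hsn, a, ?_⟩
  set G := map (Int.castRingHom ℚ) F
  have hG : G.IsHomogeneous 4 := hF.map _
  rw [← Ideal.span_union]
  set S := (Set.range fun i => pderiv i G) ∪ (Set.range fun i => linForm (a i))
  have hhom : (Ideal.span S).IsHomogeneous (homogeneousSubmodule (Fin n) ℚ) := by
    refine Ideal.homogeneous_span _ _ ?_
    rintro _ (⟨i, rfl⟩ | ⟨i, rfl⟩)
    · exact ⟨3, hG.pderiv⟩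
    · exact ⟨1, linForm_isHomogeneous _⟩
  -- By Euler's identity `4G = ∑ Xᵢ ∂ᵢG`, so `G` itself need not be among the generators.
  have hGS : G ∈ Ideal.span S := by
    have h1 := hG.sum_X_mul_pderiv
    have h2 : (4 : ℕ) • G ∈ Ideal.span S := by
      rw [← h1]
      exact Ideal.sum_mem _ fun i _ => Ideal.mul_mem_left _ _
        (Ideal.subset_span (Or.inl ⟨i, rfl⟩))
    have h3 := Ideal.mul_mem_left _ (C ((4 : ℚ)⁻¹)) h2
    rwa [nsmul_eq_mul, ← mul_assoc, show ((4 : ℕ) : MvPolynomial (Fin n) ℚ) = C (4 : ℚ) from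
      (map_ofNat C 4).symm, ← C_mul, inv_mul_cancel₀ (by norm_num), C_1, one_mul] at h3
  -- The radical of a homogeneous ideal is the intersection of the homogeneous primes above it. One
  -- of these missing `X j` would be a point of the intersection shown to be empty.
  have hrad : ∀ j : Fin n, (X j : MvPolynomial (Fin n) ℚ) ∈ (Ideal.span S).radical := by
    intro j
    rw [hhom.radical_eq]
    refine Ideal.mem_sInf.2 ?_
    rintro J ⟨hJ, hSJ, hJp⟩
    by_contra hj
    let x : RatProj n := ⟨⟨J, hJ⟩, hJp, fun hle => hj (hle
      (HomogeneousIdeal.mem_irrelevant_of_mem _ one_pos (isHomogeneous_X ℚ j)))⟩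
    have hx : x ∈ singLocus F ∩ ProjectiveSpectrum.zeroLocus (homogeneousSubmodule (Fin n) ℚ)
        (Set.range fun i => linForm (a i)) := by
      constructor
      · rintro f (rfl | ⟨i, rfl⟩)
        · exact hSJ hGS
        · exact hSJ (Ideal.subset_span (Or.inl ⟨i, rfl⟩))
      · rintro _ ⟨i, rfl⟩
        exact hSJ (Ideal.subset_span (Or.inr ⟨i, rfl⟩))
    rw [ha] at hx
    exact hx
  choose N hN using hrad
  refine ⟨∑ j, N j, fun j => ?_⟩
  rw [← Finset.add_sum_erase _ _ (Finset.mem_univ j), pow_add]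
  exact Ideal.mul_mem_right _ _ (hN j)

end QuarticWeyl
end


noncomputable section

namespace QuarticWeyl

open MvPolynomial

attribute [local instance] MvPolynomial.gradedAlgebra

/-! ### Points on affine cones with finite linear projections -/

lemma homogeneousComponent_mul_right {τ : Type*} {p q : MvPolynomial τ ℚ} {e : ℕ}
    (hq : q.IsHomogeneous e) (d : ℕ) :
    homogeneousComponent (d + e) (p * q) = homogeneousComponent d p * q := by
  rw [← coe_decompose_eq, ← coe_decompose_eq]
  exact DirectSum.coe_decompose_mul_add_of_right_mem (homogeneousSubmodule τ ℚ) (a := p) (b := q)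
    (i := d) (j := e) hq

lemma exists_separating {τ : Type*} (E : Finset (τ → ℚ)) (x : τ → ℚ) :
    ∃ p : MvPolynomial τ ℚ, eval x p = 1 ∧ ∀ y ∈ E, y ≠ x → eval y p = 0 := by
  classical
  have h : ∀ y : τ → ℚ, ∃ p : MvPolynomial τ ℚ, eval x p = 1 ∧ (y ≠ x → eval y p = 0) := by
    intro y
    by_cases hy : y = x
    · exact ⟨1, by simp, fun h => absurd hy h⟩
    · obtain ⟨j, hj⟩ := Function.ne_iff.1 hy
      have hne : x j - y j ≠ 0 := sub_ne_zero.2 (Ne.symm hj)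
      refine ⟨C ((x j - y j)⁻¹) * (X j - C (y j)), ?_, fun _ => by simp⟩
      simp [hne]
  choose p hp1 hp0 using h
  refine ⟨∏ y ∈ E, p y, ?_, fun y hy hyx => ?_⟩
  · rw [map_prod]
    exact Finset.prod_eq_one fun y _ => hp1 y
  · rw [map_prod]
    exact Finset.prod_eq_zero hy (hp0 y hyx)

/-- If the linear forms `ℓ` and the forms `G` have no common zero but the origin, the fibres of `ℓ`
on the zero set of `G` are uniformly finite. -/
theorem exists_card_fibre_le {τ ι κ : Type*} [Fintype τ] [Fintype κ]
    {G : ι → MvPolynomial τ ℚ} {e : ι → ℕ} (hG : ∀ i, (G i).IsHomogeneous (e i))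
    {l : κ → MvPolynomial τ ℚ} (hl : ∀ k, (l k).IsHomogeneous 1) {N : ℕ}
    (hN : ∀ j, (X j : MvPolynomial τ ℚ) ^ N ∈
      Ideal.span (Set.range G) ⊔ Ideal.span (Set.range l)) :
    ∃ D : ℕ, ∀ (v : κ → ℚ) (E : Finset (τ → ℚ)),
      (∀ x ∈ E, (∀ i, eval x (G i) = 0) ∧ ∀ k, eval x (l k) = v k) → E.card ≤ D := by
  classical
  -- Any monomial of degree above `M` has a variable with exponent at least `N`, hence lies in the
  -- ideal.
  set M := Fintype.card τ * N with hM
  let S : Finset (τ →₀ ℕ) := Finset.Iic (Finsupp.equivFunOnFinite.symm fun _ => M)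
  refine ⟨S.card, fun v E hE => ?_⟩
  let ev : MvPolynomial τ ℚ →ₗ[ℚ] (E → ℚ) := LinearMap.pi fun x => (aeval (R := ℚ) x.1).toLinearMap
  have hev : ∀ p x, ev p x = eval x.1 p := fun p x => by
    simp [ev]
  let b : (τ →₀ ℕ) → (E → ℚ) := fun m => ev (monomial m 1)
  let W : Submodule ℚ (E → ℚ) := Submodule.span ℚ ((S.image b : Finset (E → ℚ)) : Set (E → ℚ))
  have hsmall : ∀ d ≤ M, ∀ p : MvPolynomial τ ℚ, p.IsHomogeneous d → ev p ∈ W := by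
    intro d hd p hp
    rw [p.as_sum, map_sum]
    refine Submodule.sum_mem _ fun m hm => ?_
    have hdeg : m.degree = d := by
      rw [Finsupp.degree_eq_weight_one]; exact hp (mem_support_iff.1 hm)
    have hmS : m ∈ S := by
      rw [Finset.mem_Iic]
      intro j
      have := Finsupp.le_degree j m
      simp; omega
    have : (monomial m) (coeff m p) = coeff m p • monomial m (1 : ℚ) := by
      rw [smul_monomial]; simp
    rw [this, map_smul]
    exact Submodule.smul_mem _ _ (Submodule.subset_span (Finset.mem_coe.2
      (Finset.mem_image_of_mem b hmS)))
  have hbig : ∀ d, M < d → ∀ p : MvPolynomial τ ℚ, p.IsHomogeneous d →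
      p ∈ Ideal.span (Set.range G) ⊔ Ideal.span (Set.range l) := by
    intro d hd p hp
    rw [p.as_sum]
    refine Ideal.sum_mem _ fun m hm => ?_
    have hdeg : m.degree = d := by
      rw [Finsupp.degree_eq_weight_one]; exact hp (mem_support_iff.1 hm)
    obtain ⟨j, hj⟩ : ∃ j, N ≤ m j := by
      by_contra! hlt
      have : m.degree ≤ M := by
        rw [Finsupp.degree_eq_sum, hM, ← smul_eq_mul]
        exact Finset.sum_le_card_nsmul _ _ _ fun j _ => (hlt j).le
      omega
    have hle : Finsupp.single j N ≤ m := by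
      simpa using hj
    have : (monomial m) (coeff m p) = X j ^ N * monomial (m - Finsupp.single j N) (coeff m p) := by
      rw [X_pow_eq_monomial, monomial_mul, one_mul, add_tsub_cancel_of_le hle]
    rw [this]
    exact Ideal.mul_mem_right _ _ (hN j)
  have hkill : ∀ d, ∀ g ∈ Ideal.span (Set.range G), ev (homogeneousComponent d g) = 0 := by
    intro d g hg
    have hhom : (Ideal.span (Set.range G)).IsHomogeneous (homogeneousSubmodule τ ℚ) :=
      Ideal.homogeneous_span _ _ (by rintro _ ⟨i, rfl⟩; exact ⟨e i, hG i⟩)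
    have h1 : homogeneousComponent d g ∈ Ideal.span (Set.range G) := by
      rw [← coe_decompose_eq]; exact hhom d hg
    ext x
    rw [hev]
    have h2 : Ideal.span (Set.range G) ≤ RingHom.ker (eval x.1) :=
      Ideal.span_le.2 (by rintro _ ⟨i, rfl⟩; exact (hE x.1 x.2).1 i)
    exact h2 h1
  -- In degree above `M`, write `p = g + ∑ cₖ lₖ` with `g` in the ideal of the `G i`. On `E` the
  -- form `g` vanishes and `lₖ` is the constant `v k`, so `p` agrees there with a combination of
  -- forms of degree one less. Thus monomials from `S` span all polynomial functions on `E`.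
  have hall : ∀ d, ∀ p : MvPolynomial τ ℚ, p.IsHomogeneous d → ev p ∈ W := by
    intro d
    induction d with
    | zero => exact hsmall 0 (Nat.zero_le _)
    | succ d ih =>
      intro p hp
      rcases le_or_gt (d + 1) M with hd | hd
      · exact hsmall _ hd p hp
      obtain ⟨g, hg, q, hq, hgq⟩ := Submodule.mem_sup.1 (hbig _ hd p hp)
      obtain ⟨c, hc⟩ := (Ideal.mem_span_range_iff_exists_fun).1 hq
      have h1 : p = homogeneousComponent (d + 1) g +
          ∑ k, homogeneousComponent d (c k) * l k := by
        have h2 : homogeneousComponent (d + 1) p = p := by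
          rw [homogeneousComponent_of_mem hp, if_pos rfl]
        rw [← h2, ← hgq, map_add, ← hc, map_sum]
        congr 1
        exact Finset.sum_congr rfl fun k _ => homogeneousComponent_mul_right (hl k) d
      have h3 : ev p = ∑ k, v k • ev (homogeneousComponent d (c k)) := by
        rw [h1, map_add, hkill _ _ hg, zero_add, map_sum]
        refine Finset.sum_congr rfl fun k _ => ?_
        ext x
        simp only [hev, map_mul, Pi.smul_apply, (hE x.1 x.2).2 k, smul_eq_mul, mul_comm]
      rw [h3]
      exact Submodule.sum_mem _ fun k _ => Submodule.smul_mem _ _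
        (ih _ (homogeneousComponent_isHomogeneous _ _))
  -- Interpolation: every function on the finite set `E` is polynomial, so `E.card` is at most the
  -- number of spanning monomials.
  have htop : W = ⊤ := by
    rw [eq_top_iff]
    intro f _
    have hsep := fun x : E => exists_separating E x.1
    choose s hs1 hs0 using hsep
    have hf : f = ev (∑ x : E, C (f x) * s x) := by
      ext y
      rw [hev, map_sum, Finset.sum_eq_single y]
      · simp [hs1]
      · intro x _ hxy
        simp [hs0 x y.1 y.2 (fun h => hxy (Subtype.ext h.symm))]
      · simp
    rw [hf, ← sum_homogeneousComponent (∑ x : E, C (f x) * s x), map_sum]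
    exact Submodule.sum_mem _ fun d _ => hall d _ (homogeneousComponent_isHomogeneous _ _)
  have h1 : Module.finrank ℚ W ≤ (S.image b).card := finrank_span_finset_le_card _
  rw [htop, finrank_top, Module.finrank_fintype_fun_eq_card, Fintype.card_coe] at h1
  exact h1.trans Finset.card_image_le

end QuarticWeyl
end


noncomputable section

namespace QuarticWeyl

open MvPolynomial

attribute [local instance] MvPolynomial.gradedAlgebra

/-! ### The symmetric multilinear forms attached to a quartic form -/

/-- The fourth partial derivatives of a quartic form. -/
def tensor {n : ℕ} (F : MvPolynomial (Fin n) ℤ) (i j k l : Fin n) : ℤ :=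
  constantCoeff (pderiv l (pderiv k (pderiv j (pderiv i F))))

/-- The trilinear forms whose diagonal is the gradient of `6 F`. -/
def trilin {n : ℕ} (F : MvPolynomial (Fin n) ℤ) (x y w : Fin n → ℤ) (i : Fin n) : ℤ :=
  ∑ j, ∑ k, ∑ l, tensor F i j k l * (x j * y k * w l)

/-- The quadrilinear form whose diagonal is `24 F`. -/
def quadrilin {n : ℕ} (F : MvPolynomial (Fin n) ℤ) (x y w u : Fin n → ℤ) : ℤ :=
  ∑ i, ∑ j, ∑ k, ∑ l, tensor F i j k l * (x i * y j * w k * u l)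

lemma pderiv_pderiv_comm {n : ℕ} (i j : Fin n) (p : MvPolynomial (Fin n) ℤ) :
    pderiv i (pderiv j p) = pderiv j (pderiv i p) := by
  have h : ⁅(pderiv i : Derivation ℤ (MvPolynomial (Fin n) ℤ) (MvPolynomial (Fin n) ℤ)),
      (pderiv j : Derivation ℤ (MvPolynomial (Fin n) ℤ) (MvPolynomial (Fin n) ℤ))⁆ = 0 := by
    refine MvPolynomial.derivation_ext fun k => ?_
    rw [Derivation.commutator_apply]
    simp [pderiv_X, Pi.single_apply, apply_ite]
  have h2 := congrArg (fun D : Derivation ℤ (MvPolynomial (Fin n) ℤ) (MvPolynomial (Fin n) ℤ) => D p) h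
  rw [Derivation.commutator_apply] at h2
  exact sub_eq_zero.1 h2

lemma tensor_swap₁ {n : ℕ} (F : MvPolynomial (Fin n) ℤ) (i j k l : Fin n) :
    tensor F i j k l = tensor F j i k l := by
  unfold tensor; rw [pderiv_pderiv_comm j i]

lemma tensor_swap₂ {n : ℕ} (F : MvPolynomial (Fin n) ℤ) (i j k l : Fin n) :
    tensor F i j k l = tensor F i k j l := by
  unfold tensor; rw [pderiv_pderiv_comm k j]

lemma tensor_swap₃ {n : ℕ} (F : MvPolynomial (Fin n) ℤ) (i j k l : Fin n) :
    tensor F i j k l = tensor F i j l k := by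
  unfold tensor; rw [pderiv_pderiv_comm l k]

lemma eq_sum_of_isHomogeneous_one {n : ℕ} {p : MvPolynomial (Fin n) ℤ} (hp : p.IsHomogeneous 1) :
    p = ∑ l, X l * C (constantCoeff (pderiv l p)) := by
  have h := hp.sum_X_mul_pderiv
  rw [one_smul] at h
  conv_lhs => rw [← h]
  refine Finset.sum_congr rfl fun l _ => ?_
  congr 1
  have h0 : (pderiv l p).IsHomogeneous 0 := hp.pderiv
  rw [constantCoeff_eq]
  exact totalDegree_eq_zero_iff_eq_C.1 (Nat.le_zero.1 h0.totalDegree_le)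

/-- Euler's identity in degrees 3, 2 and 1. The factor `6` keeps the coefficients integral. -/
lemma six_smul_eq_sum {n : ℕ} {p : MvPolynomial (Fin n) ℤ} (hp : p.IsHomogeneous 3) :
    6 • p = ∑ j, ∑ k, ∑ l, C (constantCoeff (pderiv l (pderiv k (pderiv j p)))) *
      (X j * X k * X l) := by
  have h1 : 6 • p = ∑ j, X j * (2 • pderiv j p) := by
    rw [show (6 : ℕ) = 2 * 3 from rfl, mul_smul, ← hp.sum_X_mul_pderiv, Finset.smul_sum]
    exact Finset.sum_congr rfl fun j _ => (mul_smul_comm _ _ _).symm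
  rw [h1]
  refine Finset.sum_congr rfl fun j _ => ?_
  have hj : (pderiv j p).IsHomogeneous 2 := hp.pderiv
  rw [← hj.sum_X_mul_pderiv, Finset.mul_sum]
  refine Finset.sum_congr rfl fun k _ => ?_
  have hk : (pderiv k (pderiv j p)).IsHomogeneous 1 := hj.pderiv
  conv_lhs => rw [eq_sum_of_isHomogeneous_one hk, Finset.mul_sum, Finset.mul_sum]
  exact Finset.sum_congr rfl fun l _ => by ring

lemma smul_eval_eq_quadrilin {n : ℕ} {F : MvPolynomial (Fin n) ℤ} (hF : F.IsHomogeneous 4)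
    (x : Fin n → ℤ) : 24 * eval x F = quadrilin F x x x x := by
  have h1 : 24 • F = ∑ i, X i * (6 • pderiv i F) := by
    rw [show (24 : ℕ) = 6 * 4 from rfl, mul_smul, ← hF.sum_X_mul_pderiv, Finset.smul_sum]
    exact Finset.sum_congr rfl fun j _ => (mul_smul_comm _ _ _).symm
  have h2 := congrArg (eval x) h1
  simp only [map_nsmul, map_sum, map_mul, eval_X] at h2
  rw [nsmul_eq_mul] at h2
  push_cast at h2
  rw [h2]
  unfold quadrilin
  refine Finset.sum_congr rfl fun i _ => ?_
  rw [← map_nsmul, six_smul_eq_sum hF.pderiv]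
  simp only [map_sum, map_mul, eval_X, eval_C, Finset.mul_sum]
  refine Finset.sum_congr rfl fun j _ => Finset.sum_congr rfl fun k _ =>
    Finset.sum_congr rfl fun l _ => ?_
  unfold tensor; ring

/-- The integer vectors with all coordinates at most `W` in absolute value. -/
def ibox (n : ℕ) (W : ℝ) : Finset (Fin n → ℤ) :=
  Fintype.piFinset fun _ => Finset.Icc (-⌊W⌋) ⌊W⌋

lemma mem_ibox {n : ℕ} {W : ℝ} {x : Fin n → ℤ} : x ∈ ibox n W ↔ ∀ i, |(x i : ℝ)| ≤ W := by
  simp only [ibox, Fintype.mem_piFinset, Finset.mem_Icc]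
  refine forall_congr' fun i => ?_
  rw [← abs_le, Int.le_floor]; push_cast; rfl

/-- The trilinear forms as polynomials in three sets of variables. -/
def trilinPoly {n : ℕ} (F : MvPolynomial (Fin n) ℤ) (i : Fin n) :
    MvPolynomial (Fin 3 × Fin n) ℚ :=
  ∑ j, ∑ k, ∑ l, C (tensor F i j k l : ℚ) * (X (0, j) * X (1, k) * X (2, l))

lemma trilinPoly_isHomogeneous {n : ℕ} (F : MvPolynomial (Fin n) ℤ) (i : Fin n) :
    (trilinPoly F i).IsHomogeneous 3 := by
  refine IsHomogeneous.sum _ _ _ fun j _ => IsHomogeneous.sum _ _ _ fun k _ =>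
    IsHomogeneous.sum _ _ _ fun l _ => ?_
  simpa using (isHomogeneous_C (Fin 3 × Fin n) (tensor F i j k l : ℚ)).mul
    (((isHomogeneous_X ℚ _).mul (isHomogeneous_X ℚ _)).mul (isHomogeneous_X ℚ _))

/-- The linear forms cutting out, inside the diagonal, a complement of the singular cone. -/
def diagForms {n s : ℕ} (a : Fin s → Fin n → ℤ) :
    (Fin n ⊕ Fin n) ⊕ Fin s → MvPolynomial (Fin 3 × Fin n) ℚ :=
  Sum.elim (Sum.elim (fun j => X (0, j) - X (1, j)) (fun j => X (0, j) - X (2, j)))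
    (fun t => rename (Prod.mk 0) (linForm (a t)))

/-- Modulo the diagonal forms the three blocks of variables coincide and the trilinear forms become
`6 ∂ᵢF`, so the relation for the gradient carries over to each block. -/
lemma X_pow_mem_trilin {n s N : ℕ} {F : MvPolynomial (Fin n) ℤ} (hF : F.IsHomogeneous 4)
    {a : Fin s → Fin n → ℤ} (h : ∀ j : Fin n, (X j : MvPolynomial (Fin n) ℚ) ^ N ∈
        Ideal.span (Set.range fun i => pderiv i (map (Int.castRingHom ℚ) F)) ⊔
        Ideal.span (Set.range fun i => linForm (a i))) (p : Fin 3 × Fin n) :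
    (X p : MvPolynomial (Fin 3 × Fin n) ℚ) ^ N ∈
      Ideal.span (Set.range (trilinPoly F)) ⊔ Ideal.span (Set.range (diagForms a)) := by
  set J := Ideal.span (Set.range (trilinPoly F)) ⊔ Ideal.span (Set.range (diagForms a))
  have hT : ∀ i, trilinPoly F i ∈ J := fun i =>
    Ideal.mem_sup_left (Ideal.subset_span ⟨i, rfl⟩)
  have hD : ∀ i, diagForms a i ∈ J := fun i =>
    Ideal.mem_sup_right (Ideal.subset_span ⟨i, rfl⟩)
  let π := Ideal.Quotient.mk J
  have h1 : ∀ j, π (X (1, j)) = π (X (0, j)) := fun j =>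
    (Ideal.Quotient.eq.2 (hD (Sum.inl (Sum.inl j)))).symm
  have h2 : ∀ j, π (X (2, j)) = π (X (0, j)) := fun j =>
    (Ideal.Quotient.eq.2 (hD (Sum.inl (Sum.inr j)))).symm
  have h0 : ∀ t j, π (X (t, j)) = π (X (0, j)) := by
    intro t j
    fin_cases t
    · rfl
    · exact h1 j
    · exact h2 j
  let ρ : MvPolynomial (Fin n) ℚ →ₐ[ℚ] MvPolynomial (Fin 3 × Fin n) ℚ := rename (Prod.mk 0)
  have hgrad : ∀ i, ρ (pderiv i (map (Int.castRingHom ℚ) F)) ∈ J := by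
    intro i
    have e1 := congrArg (fun p => ρ (map (Int.castRingHom ℚ) p))
      (six_smul_eq_sum (p := pderiv i F) hF.pderiv)
    simp only [map_nsmul, map_sum, map_mul, map_C, map_X] at e1
    rw [← pderiv_map] at e1
    have e2 : π (6 • ρ (pderiv i (map (Int.castRingHom ℚ) F))) = π (trilinPoly F i) := by
      rw [e1]
      simp only [trilinPoly, map_sum, map_mul, h1, h2, ρ, rename_X]
      refine Finset.sum_congr rfl fun j _ => Finset.sum_congr rfl fun k _ =>
        Finset.sum_congr rfl fun l _ => ?_
      congr 2
      simp [tensor]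
    have e3 : 6 • ρ (pderiv i (map (Int.castRingHom ℚ) F)) ∈ J := by
      rw [← Ideal.Quotient.eq_zero_iff_mem]
      exact e2.trans (Ideal.Quotient.eq_zero_iff_mem.2 (hT i))
    have e4 := Ideal.mul_mem_left _ (C ((6 : ℚ)⁻¹)) e3
    rwa [nsmul_eq_mul, ← mul_assoc, show ((6 : ℕ) : MvPolynomial (Fin 3 × Fin n) ℚ) = C (6 : ℚ) from
      (map_ofNat C 6).symm, ← C_mul, inv_mul_cancel₀ (by norm_num), C_1, one_mul] at e4
  have hle : Ideal.span (Set.range fun i => pderiv i (map (Int.castRingHom ℚ) F)) ⊔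
        Ideal.span (Set.range fun i => linForm (a i)) ≤ J.comap ρ := by
    refine sup_le (Ideal.span_le.2 ?_) (Ideal.span_le.2 ?_)
    · rintro _ ⟨i, rfl⟩; exact hgrad i
    · rintro _ ⟨i, rfl⟩; exact hD (Sum.inr i)
  have h3 : (X (0, p.2) : MvPolynomial (Fin 3 × Fin n) ℚ) ^ N ∈ J := by
    have := hle (h p.2)
    simpa [ρ] using this
  rw [← Ideal.Quotient.eq_zero_iff_mem] at h3 ⊢
  rw [map_pow] at h3 ⊢
  rw [← h3]
  exact congrArg (· ^ N) (h0 p.1 p.2)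

/-- The common zeros of the trilinear forms in a box. -/
def trilinZeros {n : ℕ} (F : MvPolynomial (Fin n) ℤ) (W : ℝ) :
    Finset ((Fin n → ℤ) × (Fin n → ℤ) × (Fin n → ℤ)) :=
  (ibox n W ×ˢ ibox n W ×ˢ ibox n W).filter fun t => trilin F t.1 t.2.1 t.2.2 = 0

/-- The `2n + s` diagonal and linear forms map the zeros to integer vectors of size `O(W)`, with
fibres bounded by `exists_card_fibre_le`. -/
theorem exists_card_trilinZeros_le {n : ℕ} {F : MvPolynomial (Fin n) ℤ} (hF : F.IsHomogeneous 4) :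
    ∃ s : ℕ, (s : ℤ) = sigma F + 1 ∧ s ≤ n ∧ ∃ C : ℝ, 0 < C ∧ ∀ W : ℝ, 1 ≤ W →
      ((trilinZeros F W).card : ℝ) ≤ C * W ^ (2 * n + s) := by
  classical
  obtain ⟨s, hs, hsn, a, N, hN⟩ := exists_X_pow_mem hF
  refine ⟨s, hs, hsn, ?_⟩
  have hl : ∀ k, (diagForms a k).IsHomogeneous 1 := by
    rintro ((j | j) | t)
    · exact (isHomogeneous_X ℚ _).sub (isHomogeneous_X ℚ _)
    · exact (isHomogeneous_X ℚ _).sub (isHomogeneous_X ℚ _)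
    · exact (linForm_isHomogeneous (a t)).rename_isHomogeneous
  obtain ⟨D, hD⟩ := exists_card_fibre_le (trilinPoly_isHomogeneous F) hl (X_pow_mem_trilin hF hN)
  set A : ℤ := ∑ t, ∑ j, |a t j| with hA
  have hA0 : 0 ≤ A := Finset.sum_nonneg fun t _ => Finset.sum_nonneg fun j _ => abs_nonneg _
  -- Differences of coordinates are at most `2W` and the linear forms at most `AW`; `2 + A` serves
  -- for both.
  refine ⟨(D + 1) * (2 * (2 + A) + 1) ^ (2 * n + s), by positivity, fun W hW => ?_⟩
  let val : ((Fin n → ℤ) × (Fin n → ℤ) × (Fin n → ℤ)) → ((Fin n ⊕ Fin n) ⊕ Fin s → ℤ) :=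
    fun t => Sum.elim (Sum.elim (fun j => t.1 j - t.2.1 j) (fun j => t.1 j - t.2.2 j))
      (fun r => ∑ j, a r j * t.1 j)
  let R : Finset ((Fin n ⊕ Fin n) ⊕ Fin s → ℤ) :=
    Fintype.piFinset fun _ => Finset.Icc (-((2 + A) * ⌊W⌋)) ((2 + A) * ⌊W⌋)
  have hW0 : 1 ≤ ⌊W⌋ := Int.le_floor.2 (by simpa using hW)
  have hmaps : ∀ t ∈ trilinZeros F W, val t ∈ R := by
    rintro ⟨x, y, w⟩ ht
    simp only [trilinZeros, ibox, Finset.mem_filter, Finset.mem_product, Fintype.mem_piFinset,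
      Finset.mem_Icc] at ht
    obtain ⟨⟨hx, hy, hw⟩, -⟩ := ht
    simp only [R, Fintype.mem_piFinset, Finset.mem_Icc]
    rintro ((j | j) | r)
    · have := hx j; have := hy j
      constructor <;> simp only [val, Sum.elim_inl] <;> nlinarith
    · have := hx j; have := hw j
      constructor <;> simp only [val, Sum.elim_inl, Sum.elim_inr] <;> nlinarith
    · rw [← abs_le]
      simp only [val, Sum.elim_inr]
      calc |∑ j, a r j * x j| ≤ ∑ j, |a r j * x j| := Finset.abs_sum_le_sum_abs _ _
        _ ≤ ∑ j, |a r j| * ⌊W⌋ := Finset.sum_le_sum fun j _ => by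
            rw [abs_mul]
            exact mul_le_mul_of_nonneg_left (abs_le.2 (hx j)) (abs_nonneg _)
        _ = (∑ j, |a r j|) * ⌊W⌋ := by rw [Finset.sum_mul]
        _ ≤ A * ⌊W⌋ := by
            refine mul_le_mul_of_nonneg_right ?_ (by omega)
            exact Finset.single_le_sum (f := fun r => ∑ j, |a r j|)
              (fun t _ => Finset.sum_nonneg fun j _ => abs_nonneg _) (Finset.mem_univ r)
        _ ≤ (2 + A) * ⌊W⌋ := by nlinarith
  have hfib : ∀ v ∈ R, ((trilinZeros F W).filter fun t => val t = v).card ≤ D := by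
    intro v _
    let emb : ((Fin n → ℤ) × (Fin n → ℤ) × (Fin n → ℤ)) → (Fin 3 × Fin n → ℚ) :=
      fun t p => ((![t.1, t.2.1, t.2.2] p.1 p.2 : ℤ) : ℚ)
    have hemb : Function.Injective emb := by
      rintro ⟨x, y, w⟩ ⟨x', y', w'⟩ h
      have h' : ∀ (t : Fin 3) (j : Fin n), ![x, y, w] t j = ![x', y', w'] t j := fun t j =>
        Int.cast_injective (α := ℚ) (congrFun h (t, j))
      have e0 : x = x' := funext fun j => h' 0 j
      have e1 : y = y' := funext fun j => h' 1 j
      have e2 : w = w' := funext fun j => h' 2 j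
      rw [e0, e1, e2]
    rw [← Finset.card_image_of_injective _ hemb]
    refine hD (fun k => (v k : ℚ)) _ fun z hz => ?_
    obtain ⟨⟨x, y, w⟩, ht, rfl⟩ := Finset.mem_image.1 hz
    rw [Finset.mem_filter, trilinZeros, Finset.mem_filter] at ht
    obtain ⟨⟨-, h0⟩, hv⟩ := ht
    constructor
    · intro i
      have := congrArg (Int.cast (R := ℚ)) (congrFun h0 i)
      simp only [trilin, Pi.zero_apply, Int.cast_sum, Int.cast_mul, Int.cast_zero] at this
      simpa [trilinPoly, emb] using this
    · intro k
      rw [← hv]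
      rcases k with (j | j) | r
      · simp [diagForms, emb, val]
      · simp [diagForms, emb, val]
      · simp [diagForms, emb, val, linForm]
  have hcard := Finset.card_le_mul_card_image_of_maps_to hmaps D hfib
  have hR : (R.card : ℝ) ≤ ((2 * (2 + A) + 1) * W) ^ (2 * n + s) := by
    simp only [R, Fintype.card_piFinset, Finset.prod_const, Finset.card_univ, Fintype.card_sum,
      Fintype.card_fin, Int.card_Icc]
    rw [show n + n + s = 2 * n + s by ring]
    push_cast
    refine pow_le_pow_left₀ (by positivity) ?_ _
    have hpos : 0 ≤ (2 + A) * ⌊W⌋ := by positivity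
    have e : (((2 + A) * ⌊W⌋ + 1 - -((2 + A) * ⌊W⌋)).toNat : ℝ) = 2 * (2 + A) * ⌊W⌋ + 1 := by
      have : (((2 + A) * ⌊W⌋ + 1 - -((2 + A) * ⌊W⌋)).toNat : ℤ) = 2 * (2 + A) * ⌊W⌋ + 1 := by
        rw [Int.toNat_of_nonneg (by linarith)]; ring
      exact_mod_cast this
    rw [e]
    have h1 : (⌊W⌋ : ℝ) ≤ W := Int.floor_le W
    have h2 : (0 : ℝ) ≤ A := by exact_mod_cast hA0
    nlinarith
  calc ((trilinZeros F W).card : ℝ) ≤ D * R.card := by exact_mod_cast hcard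
    _ ≤ (D + 1) * ((2 * (2 + A) + 1) * W) ^ (2 * n + s) :=
        mul_le_mul (by linarith) hR (by positivity) (by positivity)
    _ = _ := by rw [mul_pow]; ring

end QuarticWeyl
end


noncomputable section

namespace QuarticWeyl

/-! ### Additive characters and geometric sums -/

/-- `ee t = e^{2πit}`. -/
def ee (t : ℝ) : ℂ := Complex.exp (2 * Real.pi * Complex.I * t)

lemma ee_eq (t : ℝ) : ee t = Complex.exp (Complex.I * ((2 * Real.pi * t : ℝ) : ℂ)) := by
  unfold ee; congr 1; push_cast; ring

@[simp] lemma norm_ee (t : ℝ) : ‖ee t‖ = 1 := by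
  rw [ee_eq, mul_comm, Complex.norm_exp_ofReal_mul_I]

lemma ee_add (s t : ℝ) : ee (s + t) = ee s * ee t := by
  unfold ee; rw [← Complex.exp_add]; congr 1; push_cast; ring

@[simp] lemma ee_int (m : ℤ) : ee m = 1 := by
  unfold ee
  rw [show (2 * Real.pi * Complex.I * ((m : ℝ) : ℂ) : ℂ) = m * (2 * Real.pi * Complex.I) by
    push_cast; ring]
  exact Complex.exp_int_mul_two_pi_mul_I m

lemma ee_add_int (t : ℝ) (m : ℤ) : ee (t + m) = ee t := by rw [ee_add, ee_int, mul_one]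

lemma conj_ee (t : ℝ) : (starRingEnd ℂ) (ee t) = ee (-t) := by
  unfold ee
  rw [← Complex.exp_conj]
  congr 1
  simp [map_ofNat]

lemma ee_sum {ι : Type*} (s : Finset ι) (f : ι → ℝ) : ee (∑ i ∈ s, f i) = ∏ i ∈ s, ee (f i) := by
  unfold ee; rw [← Complex.exp_sum]; congr 1; push_cast; rw [Finset.mul_sum]

lemma norm_ee_sub_one_le (t : ℝ) : ‖ee t - 1‖ ≤ 2 * Real.pi * |t| := by
  rw [ee_eq]
  refine (Real.norm_exp_I_mul_ofReal_sub_one_le).trans ?_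
  rw [Real.norm_eq_abs, abs_mul, abs_of_pos Real.two_pi_pos]

/-- `|e(t) - 1| = 2|sin πt|`, and `sin x ≥ 2x/π` on `[0, π/2]`. -/
lemma four_mul_fract_le (t : ℝ) (h : Int.fract t ≤ 1 / 2) : 4 * Int.fract t ≤ ‖ee t - 1‖ := by
  have h0 := Int.fract_nonneg t
  have h1 : ee t = ee (Int.fract t) := by
    conv_lhs => rw [← Int.fract_add_floor t]
    exact ee_add_int _ _
  rw [h1, ee_eq, Complex.norm_exp_I_mul_ofReal_sub_one, Real.norm_eq_abs]
  have h2 := Real.mul_le_sin (x := Real.pi * Int.fract t) (by positivity)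
    (by nlinarith [Real.pi_pos])
  have h3 : 2 / Real.pi * (Real.pi * Int.fract t) = 2 * Int.fract t := by
    field_simp
  rw [h3] at h2
  rw [show 2 * Real.pi * Int.fract t / 2 = Real.pi * Int.fract t by ring]
  refine le_trans ?_ (le_abs_self _)
  linarith

lemma four_mul_one_sub_fract_le (t : ℝ) (h : 1 / 2 ≤ Int.fract t) :
    4 * (1 - Int.fract t) ≤ ‖ee t - 1‖ := by
  have h0 := Int.fract_lt_one t
  have h1 : ee t = ee (Int.fract t) := by
    conv_lhs => rw [← Int.fract_add_floor t]
    exact ee_add_int _ _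
  rw [h1, ee_eq, Complex.norm_exp_I_mul_ofReal_sub_one, Real.norm_eq_abs]
  have h2 := Real.mul_le_sin (x := Real.pi * (1 - Int.fract t))
    (mul_nonneg Real.pi_pos.le (by linarith)) (by nlinarith [Real.pi_pos])
  have h3 : 2 / Real.pi * (Real.pi * (1 - Int.fract t)) = 2 * (1 - Int.fract t) := by
    field_simp
  rw [h3, show Real.pi * (1 - Int.fract t) = Real.pi - Real.pi * Int.fract t by ring,
    Real.sin_pi_sub] at h2
  rw [show 2 * Real.pi * Int.fract t / 2 = Real.pi * Int.fract t by ring]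
  refine le_trans ?_ (le_abs_self _)
  linarith

lemma norm_sum_Icc_ee_mul_le (a b : ℤ) (t : ℝ) :
    ‖∑ u ∈ Finset.Icc a b, ee (u * t)‖ * ‖ee t - 1‖ ≤ 2 := by
  rw [← norm_mul]
  rcases lt_or_ge b a with h | h
  · rw [Finset.Icc_eq_empty (not_le.2 h)]; simp
  have key : (∑ u ∈ Finset.Icc a b, ee (u * t)) * (ee t - 1) = ee ((b + 1) * t) - ee (a * t) := by
    induction b, h using Int.leInduction with
    | base => rw [Finset.Icc_self, Finset.sum_singleton, add_mul, one_mul, ee_add]; ring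
    | succ b hb ih =>
      have : Finset.Icc a (b + 1) = insert (b + 1) (Finset.Icc a b) := by
        ext u; simp only [Finset.mem_Icc, Finset.mem_insert]; omega
      rw [this, Finset.sum_insert (by simp), add_mul, ih]
      push_cast
      rw [add_mul ((b : ℝ) + 1) 1 t, one_mul, ee_add]
      ring
  rw [key]
  refine (norm_sub_le _ _).trans ?_
  rw [norm_ee, norm_ee]; norm_num

/-- Bound for a geometric sum of length at most `Q` whose ratio has its argument in the `j`-th of
`Q` arcs of equal length. -/
def wt (Q j : ℕ) : ℝ := Q / (j + 1) + Q / (Q - j)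

def cell (Q : ℕ) (t : ℝ) : ℕ := ⌊Q * Int.fract t⌋₊

lemma cell_lt {Q : ℕ} (hQ : 1 ≤ Q) (t : ℝ) : cell Q t < Q := by
  have hQ' : (0 : ℝ) < Q := by exact_mod_cast hQ
  rw [cell, Nat.floor_lt (mul_nonneg hQ'.le (Int.fract_nonneg t))]
  nlinarith [Int.fract_lt_one t]

lemma cell_le {Q : ℕ} (t : ℝ) : (cell Q t : ℝ) ≤ Q * Int.fract t :=
  Nat.floor_le (mul_nonneg (Nat.cast_nonneg _) (Int.fract_nonneg t))

lemma lt_cell_add_one {Q : ℕ} (t : ℝ) : Q * Int.fract t < cell Q t + 1 :=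
  Nat.lt_floor_add_one _

lemma wt_nonneg {Q j : ℕ} (h : j < Q) : 0 ≤ wt Q j := by
  have : (j : ℝ) < Q := by exact_mod_cast h
  exact add_nonneg (by positivity) (div_nonneg (by positivity) (by linarith))

lemma norm_sum_Icc_ee_le {a b : ℤ} {Q : ℕ} (hQ : 1 ≤ Q) (hab : b + 1 - a ≤ Q) (t : ℝ) :
    ‖∑ u ∈ Finset.Icc a b, ee (u * t)‖ ≤ wt Q (cell Q t) := by
  set S := ‖∑ u ∈ Finset.Icc a b, ee (u * t)‖
  have hS0 : 0 ≤ S := norm_nonneg _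
  have hSQ : S ≤ Q := by
    refine (norm_sum_le _ _).trans ?_
    simp only [norm_ee, Finset.sum_const, Int.card_Icc, nsmul_eq_mul, mul_one]
    have : (b + 1 - a).toNat ≤ Q := by omega
    exact_mod_cast this
  have h2 := norm_sum_Icc_ee_mul_le a b t
  have hlt := cell_lt hQ t
  have hle := cell_le (Q := Q) t
  have hgt := lt_cell_add_one (Q := Q) t
  set j := cell Q t
  have hjQ : (j : ℝ) + 1 ≤ Q := by exact_mod_cast hlt
  have hQ0 : (0 : ℝ) < Q := by exact_mod_cast hQ
  unfold wt
  rcases le_or_gt (Int.fract t) (1 / 2) with h | h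
  · have h3 := four_mul_fract_le t h
    -- In the arc `j = 0` only the trivial bound is available. For `j ≥ 1` the geometric sum gives
    -- `2Sj ≤ Q`, and `j + 1 ≤ 2j`.
    have h4 : S * (j + 1) ≤ Q := by
      rcases Nat.eq_zero_or_pos j with hj | hj
      · rw [hj]; simpa using hSQ
      · have hj1 : (1 : ℝ) ≤ j := by exact_mod_cast hj
        have h5 : S * (4 * Int.fract t) ≤ 2 := (mul_le_mul_of_nonneg_left h3 hS0).trans h2
        have h6 : S * j ≤ S * (Q * Int.fract t) := mul_le_mul_of_nonneg_left hle hS0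
        nlinarith
    have h7 : S ≤ Q / (j + 1) := (le_div_iff₀ (by positivity)).2 h4
    have h8 : (0 : ℝ) ≤ Q / (Q - j) := div_nonneg hQ0.le (by linarith)
    linarith
  · have h3 := four_mul_one_sub_fract_le t h.le
    have h4 : S * (Q - j) ≤ Q := by
      rcases Nat.lt_or_ge (j + 1) Q with hj | hj
      · have hj1 : (j : ℝ) + 2 ≤ Q := by exact_mod_cast hj
        have h5 : S * (4 * (1 - Int.fract t)) ≤ 2 := (mul_le_mul_of_nonneg_left h3 hS0).trans h2
        have h6 : S * (Q - j - 1) ≤ S * (Q * (1 - Int.fract t)) :=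
          mul_le_mul_of_nonneg_left (by linarith) hS0
        nlinarith
      · have : (Q : ℝ) ≤ j + 1 := by exact_mod_cast hj
        nlinarith
    have h7 : S ≤ Q / (Q - j) := (le_div_iff₀ (by linarith)).2 h4
    have h8 : (0 : ℝ) ≤ Q / (j + 1) := by positivity
    linarith

lemma sum_wt_le {Q : ℕ} : ∑ j ∈ Finset.range Q, wt Q j ≤ 2 * Q * (1 + Real.log Q) := by
  have h1 : ∑ j ∈ Finset.range Q, (Q : ℝ) / (j + 1) ≤ Q * (1 + Real.log Q) := by
    have h := harmonic_le_one_add_log Q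
    have e : ((harmonic Q : ℚ) : ℝ) = ∑ j ∈ Finset.range Q, ((j : ℝ) + 1)⁻¹ := by
      simp [harmonic]
    rw [e] at h
    simp only [div_eq_mul_inv, ← Finset.mul_sum]
    exact mul_le_mul_of_nonneg_left h (Nat.cast_nonneg _)
  have h2 : ∑ j ∈ Finset.range Q, (Q : ℝ) / (Q - j) = ∑ j ∈ Finset.range Q, (Q : ℝ) / (j + 1) := by
    rw [← Finset.sum_range_reflect]
    refine Finset.sum_congr rfl fun j hj => ?_
    have hj' : j + 1 ≤ Q := Finset.mem_range.1 hj
    rw [Nat.sub_sub, Nat.cast_sub (by omega)]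
    push_cast
    congr 1
    ring
  simp only [wt, Finset.sum_add_distrib, h2]
  linarith

/-! ### Counting lattice points -/

/-- The integer vectors within `Y` of `-v`. -/
def near {n : ℕ} (Y : ℝ) (v : Fin n → ℝ) : Finset (Fin n → ℤ) :=
  Fintype.piFinset fun i => Finset.Icc ⌈-v i - Y⌉ ⌊Y - v i⌋

lemma mem_near {n : ℕ} {Y : ℝ} {v : Fin n → ℝ} {m : Fin n → ℤ} :
    m ∈ near Y v ↔ ∀ i, |v i + m i| ≤ Y := by
  simp only [near, Fintype.mem_piFinset, Finset.mem_Icc, Int.ceil_le, Int.le_floor, abs_le]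
  exact forall_congr' fun i => ⟨fun h => ⟨by linarith [h.1], by linarith [h.2]⟩,
    fun h => ⟨by linarith [h.1], by linarith [h.2]⟩⟩

/-- The points of the lattice `{(u, L u + m)}` in the product of a box of size `X` and one of
size `Y`. -/
def latSet {n : ℕ} (L : (Fin n → ℤ) →+ (Fin n → ℝ)) (X Y : ℝ) :
    Finset ((Fin n → ℤ) × (Fin n → ℤ)) :=
  ((ibox n X).sigma fun u => near Y (L u)).map
    (Equiv.sigmaEquivProd (Fin n → ℤ) (Fin n → ℤ)).toEmbedding

variable {n : ℕ} {L : (Fin n → ℤ) →+ (Fin n → ℝ)} {X Y : ℝ}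

lemma mem_latSet {p : (Fin n → ℤ) × (Fin n → ℤ)} :
    p ∈ latSet L X Y ↔ (∀ i, |(p.1 i : ℝ)| ≤ X) ∧ ∀ i, |L p.1 i + p.2 i| ≤ Y := by
  rw [latSet, Finset.mem_map_equiv, Finset.mem_sigma, mem_ibox, mem_near]
  rfl

lemma card_latSet (L : (Fin n → ℤ) →+ (Fin n → ℝ)) (X Y : ℝ) :
    (latSet L X Y).card = ∑ u ∈ ibox n X, (near Y (L u)).card := by
  rw [latSet, Finset.card_map, Finset.card_sigma]

lemma latSet_mono {X' Y' : ℝ} (hX : X ≤ X') (hY : Y ≤ Y') : latSet L X Y ⊆ latSet L X' Y' := by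
  intro p hp
  rw [mem_latSet] at hp ⊢
  exact ⟨fun i => (hp.1 i).trans hX, fun i => (hp.2 i).trans hY⟩

/-- Group the `g` by the cell of side `1/Q` containing the fractional part of `L g`. Differences of
members of one cell are lattice points in the box `(2H, 1/Q)`, so no cell holds more than their
number. The sum of the weights over all cells factors into `n` harmonic sums. -/
theorem sum_prod_wt_le {Q : ℕ} (hQ : 1 ≤ Q) (H : ℝ) :
    ∑ g ∈ ibox n H, ∏ i, wt Q (cell Q (L g i)) ≤
      (2 * Q * (1 + Real.log Q)) ^ n * (latSet L (2 * H) (1 / Q)).card := by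
  have hQ0 : (0 : ℝ) < Q := by exact_mod_cast hQ
  have hmaps : ∀ g ∈ ibox n H, (fun i => cell Q (L g i)) ∈
      Fintype.piFinset (fun _ : Fin n => Finset.range Q) := fun g _ => by
    rw [Fintype.mem_piFinset]
    exact fun i => Finset.mem_range.2 (cell_lt hQ _)
  rw [← Finset.sum_fiberwise_of_maps_to hmaps]
  have hfib : ∀ J : Fin n → ℕ, ((ibox n H).filter fun g => (fun i => cell Q (L g i)) = J).card ≤
      (latSet L (2 * H) (1 / Q)).card := by
    intro J
    rcases ((ibox n H).filter fun g => (fun i => cell Q (L g i)) = J).eq_empty_or_nonempty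
      with h | ⟨g₀, hg₀⟩
    · rw [h]; simp
    rw [Finset.mem_filter, mem_ibox] at hg₀
    refine Finset.card_le_card_of_injOn
      (fun g => (g - g₀, fun i => -(⌊L g i⌋ - ⌊L g₀ i⌋))) ?_ ?_
    · intro g hg
      rw [Finset.mem_coe, Finset.mem_filter, mem_ibox] at hg
      rw [Finset.mem_coe, mem_latSet]
      constructor
      · intro i
        simp only [Pi.sub_apply, Int.cast_sub]
        refine (abs_sub _ _).trans ?_
        linarith [hg.1 i, hg₀.1 i]
      · intro i
        have e1 : cell Q (L g i) = cell Q (L g₀ i) := by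
          rw [congrFun hg.2 i, congrFun hg₀.2 i]
        have h1 := cell_le (Q := Q) (L g i)
        have h2 := lt_cell_add_one (Q := Q) (L g i)
        have h3 := cell_le (Q := Q) (L g₀ i)
        have h4 := lt_cell_add_one (Q := Q) (L g₀ i)
        rw [e1] at h1 h2
        have e2 : L (g - g₀) i + ((-(⌊L g i⌋ - ⌊L g₀ i⌋) : ℤ) : ℝ) =
            Int.fract (L g i) - Int.fract (L g₀ i) := by
          rw [map_sub, Pi.sub_apply, Int.fract, Int.fract]; push_cast; ring
        simp only [e2]
        rw [le_div_iff₀ hQ0]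
        nth_rewrite 1 [← abs_of_pos hQ0]
        rw [← abs_mul, abs_le]
        constructor <;> nlinarith
    · intro g _ g' _ h
      simpa using congrArg Prod.fst h
  calc ∑ J ∈ Fintype.piFinset (fun _ : Fin n => Finset.range Q),
        ∑ g ∈ (ibox n H).filter (fun g => (fun i => cell Q (L g i)) = J),
          ∏ i, wt Q (cell Q (L g i))
      ≤ ∑ J ∈ Fintype.piFinset (fun _ : Fin n => Finset.range Q),
          (∏ i, wt Q (J i)) * (latSet L (2 * H) (1 / Q)).card := by
        refine Finset.sum_le_sum fun J hJ => ?_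
        rw [Finset.sum_congr rfl (g := fun _ => ∏ i, wt Q (J i)) (fun g hg => by
          rw [← (Finset.mem_filter.1 hg).2]), Finset.sum_const, nsmul_eq_mul, mul_comm]
        refine mul_le_mul_of_nonneg_left (by exact_mod_cast hfib J) ?_
        exact Finset.prod_nonneg fun i _ =>
          wt_nonneg (Finset.mem_range.1 (Fintype.mem_piFinset.1 hJ i))
    _ = (∑ j ∈ Finset.range Q, wt Q j) ^ n * (latSet L (2 * H) (1 / Q)).card := by
        rw [← Finset.sum_mul, ← Finset.prod_univ_sum, Finset.prod_const, Finset.card_univ,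
          Fintype.card_fin]
    _ ≤ _ := by
        refine mul_le_mul_of_nonneg_right (pow_le_pow_left₀ ?_ sum_wt_le _) (Nat.cast_nonneg _)
        exact Finset.sum_nonneg fun j hj => wt_nonneg (Finset.mem_range.1 hj)

/-- Log-convexity of the lattice point count. -/
theorem card_latSet_mul_le {X₁ Y₁ X₂ Y₂ Xc Yc Xd Yd : ℝ} {k : ℕ} (hk : 1 ≤ k)
    (hXc : 2 * X₂ ≤ k * Xc) (hYc : 2 * Y₂ ≤ k * Yc)
    (hXd : k * X₁ + X₂ ≤ Xd) (hYd : k * Y₁ + Y₂ ≤ Yd) :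
    (latSet L X₁ Y₁).card * (latSet L X₂ Y₂).card ≤
      (latSet L Xc Yc).card * (latSet L Xd Yd).card := by
  have hk0 : (0 : ℝ) < k := by exact_mod_cast hk
  -- The image of `(p, v) ↦ kp + v` lies in the `d`-box. Two pairs in a fibre satisfy `k(p - p₀) =
  -- v₀ - v`, so `p - p₀` lies in the `c`-box and determines the pair.
  let f : ((Fin n → ℤ) × (Fin n → ℤ)) × ((Fin n → ℤ) × (Fin n → ℤ)) →
    (Fin n → ℤ) × (Fin n → ℤ) := fun pv => k • pv.1 + pv.2
  rw [← Finset.card_product]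
  refine Finset.card_le_mul_card_image_of_maps_to (f := f) ?_ _ ?_
  · rintro ⟨p, v⟩ hpv
    rw [Finset.mem_product, mem_latSet, mem_latSet] at hpv
    obtain ⟨⟨hp1, hp2⟩, hv1, hv2⟩ := hpv
    rw [mem_latSet]
    constructor
    · intro i
      simp only [f, Prod.fst_add, Prod.smul_fst, Pi.add_apply, Pi.smul_apply]
      rw [nsmul_eq_mul]
      push_cast
      refine (abs_add_le _ _).trans ?_
      rw [abs_mul, abs_of_pos hk0]
      have := hp1 i; have := hv1 i; simp only at *
      nlinarith
    · intro i
      simp only [f, Prod.fst_add, Prod.smul_fst, Pi.add_apply, Pi.smul_apply,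
        Prod.snd_add, Prod.smul_snd, map_add, map_nsmul]
      rw [nsmul_eq_mul, nsmul_eq_mul]
      push_cast
      have e : (k : ℝ) * L p.1 i + L v.1 i + (k * (p.2 i : ℝ) + v.2 i) =
        k * (L p.1 i + p.2 i) + (L v.1 i + v.2 i) := by ring
      rw [e]
      refine (abs_add_le _ _).trans ?_
      rw [abs_mul, abs_of_pos hk0]
      have := hp2 i; have := hv2 i; simp only at *
      nlinarith
  · intro d _
    rcases ((latSet L X₁ Y₁ ×ˢ latSet L X₂ Y₂).filter fun pv => f pv = d).eq_empty_or_nonempty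
      with h | ⟨⟨p₀, v₀⟩, hpv₀⟩
    · rw [h]; simp
    rw [Finset.mem_filter, Finset.mem_product, mem_latSet, mem_latSet] at hpv₀
    obtain ⟨⟨-, hv1, hv2⟩, h₀⟩ := hpv₀
    refine Finset.card_le_card_of_injOn (fun pv => pv.1 - p₀) ?_ ?_
    · rintro ⟨p, v⟩ hpv
      rw [Finset.mem_coe, Finset.mem_filter, Finset.mem_product, mem_latSet, mem_latSet] at hpv
      obtain ⟨⟨-, hw1, hw2⟩, h₁⟩ := hpv
      have e : k • (p - p₀) = v₀ - v := by
        have : k • p + v = k • p₀ + v₀ := h₁.trans h₀.symm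
        rw [smul_sub, sub_eq_sub_iff_add_eq_add, this, add_comm]
      have e1 : ∀ i, (k : ℝ) * ((p - p₀).1 i : ℝ) = v₀.1 i - v.1 i := fun i => by
        have := congrFun (congrArg Prod.fst e) i
        simp only [Prod.smul_fst, Pi.smul_apply, Prod.fst_sub, Pi.sub_apply] at this
        rw [nsmul_eq_mul] at this
        exact_mod_cast this
      have e2 : ∀ i, (k : ℝ) * ((p - p₀).2 i : ℝ) = v₀.2 i - v.2 i := fun i => by
        have := congrFun (congrArg Prod.snd e) i
        simp only [Prod.smul_snd, Pi.smul_apply, Prod.snd_sub, Pi.sub_apply] at this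
        rw [nsmul_eq_mul] at this
        exact_mod_cast this
      have e3 : ∀ i, (k : ℝ) * L (p - p₀).1 i = L v₀.1 i - L v.1 i := fun i => by
        have := congrFun (congrArg L (congrArg Prod.fst e)) i
        rwa [Prod.smul_fst, map_nsmul, Pi.smul_apply, nsmul_eq_mul, Prod.fst_sub v₀, map_sub,
          Pi.sub_apply] at this
      simp only at hv1 hv2 hw1 hw2
      rw [Finset.mem_coe, mem_latSet]
      constructor
      · intro i
        refine le_of_mul_le_mul_left ?_ hk0
        rw [← abs_of_pos hk0, ← abs_mul, abs_of_pos hk0, e1]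
        refine (abs_sub _ _).trans ?_
        linarith [hv1 i, hw1 i]
      · intro i
        refine le_of_mul_le_mul_left ?_ hk0
        rw [← abs_of_pos hk0, ← abs_mul, abs_of_pos hk0, mul_add, e3, e2,
          show L v₀.1 i - L v.1 i + (v₀.2 i - v.2 i) = (L v₀.1 i + v₀.2 i) - (L v.1 i + v.2 i) by
            ring]
        refine (abs_sub _ _).trans ?_
        linarith [hv2 i, hw2 i]
    · rintro ⟨p, v⟩ hpv ⟨p', v'⟩ hpv' h
      rw [Finset.mem_coe, Finset.mem_filter] at hpv hpv'
      have hp : p = p' := sub_left_injective h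
      have : k • p + v = k • p' + v' := hpv.2.trans hpv'.2.symm
      rw [hp] at this ⊢
      rw [add_left_cancel this]

end QuarticWeyl
end


noncomputable section

namespace QuarticWeyl

/-! ### Duality and shrinking -/

lemma ee_sum_mul_sum {n : ℕ} (s : Fin n → Finset ℤ) (v : Fin n → ℝ) :
    ∑ h ∈ Fintype.piFinset s, ee (∑ i, h i * v i) = ∏ i, ∑ h ∈ s i, ee (h * v i) := by
  rw [Finset.prod_univ_sum]
  exact Finset.sum_congr rfl fun h _ => ee_sum _ _

lemma half_le_norm_sum_ee {H : ℕ} {Y t : ℝ} (hHY : 13 * H * Y ≤ 1) {m : ℤ} (hm : |t + m| ≤ Y) :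
    (H : ℝ) / 2 ≤ ‖∑ h ∈ Finset.Ico (0 : ℤ) H, ee (h * t)‖ := by
  -- The constant `13` exceeds `4π`, so each phase moves its term by at most `1/2`.
  have h1 : ∀ h ∈ Finset.Ico (0 : ℤ) H, ‖ee (h * t) - 1‖ ≤ 1 / 2 := by
    intro h hh
    rw [Finset.mem_Ico] at hh
    have e : ee (h * t) = ee (h * (t + m)) := by
      rw [mul_add, ← Int.cast_mul, ee_add_int]
    rw [e]
    refine (norm_ee_sub_one_le _).trans ?_
    have h0 : (0 : ℝ) ≤ h := by exact_mod_cast hh.1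
    have h2 : (h : ℝ) ≤ H := by exact_mod_cast hh.2.le
    rw [abs_mul, abs_of_nonneg h0]
    have h3 : (h : ℝ) * |t + m| ≤ H * Y := mul_le_mul h2 hm (abs_nonneg _) (by positivity)
    have h4 := Real.pi_lt_d2
    have h5 : 0 ≤ (h : ℝ) * |t + m| := by positivity
    nlinarith [Real.pi_pos]
  have h2 : ∑ h ∈ Finset.Ico (0 : ℤ) H, ee (h * t) =
      (H : ℂ) + ∑ h ∈ Finset.Ico (0 : ℤ) H, (ee (h * t) - 1) := by
    rw [Finset.sum_sub_distrib]; simp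
  have h3 : ‖∑ h ∈ Finset.Ico (0 : ℤ) H, (ee (h * t) - 1)‖ ≤ H / 2 := by
    refine (norm_sum_le_of_le _ h1).trans ?_
    simp; linarith
  rw [h2]
  have h4 := norm_sub_le_norm_add (H : ℂ) (∑ h ∈ Finset.Ico (0 : ℤ) H, (ee (h * t) - 1))
  rw [Complex.norm_natCast] at h4
  linarith

variable {n : ℕ} {L : (Fin n → ℤ) →+ (Fin n → ℝ)}

/-- Symmetry of the matrix of `L`. -/
def SymmForms (L : (Fin n → ℤ) →+ (Fin n → ℝ)) : Prop :=
  ∀ u h, ∑ i, (h i : ℝ) * L u i = ∑ i, (u i : ℝ) * L h i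

/-- The sum `E u` over a dual box of side `H` is at least `(H/2)^n` in modulus whenever `L u` is
within `Y` of an integer vector. In the mean square of `E`, symmetry of `L` makes the sum over `u`
geometric with ratios given by `L (h - h')`, and `sum_prod_wt_le` applies. The self-duality of the
lattice enters here. -/
theorem card_latSet_le_dual (hL : SymmForms L) {X Y : ℝ} (hX : 0 ≤ X) {H Q : ℕ} (hH : 1 ≤ H)
    (hQ : 2 * X + 1 ≤ Q) (hHY : 13 * H * Y ≤ 1) :
    ((latSet L X Y).card : ℝ) ≤
      (8 * (Q * (1 + Real.log Q)) / H) ^ n * (latSet L (2 * H) (1 / Q)).card := by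
  classical
  have hH0 : (0 : ℝ) < H := by exact_mod_cast hH
  have hH1 : (1 : ℝ) ≤ H := by exact_mod_cast hH
  have hQ1 : 1 ≤ Q := by
    have : (1 : ℝ) ≤ Q := by linarith
    exact_mod_cast this
  let hbox : Finset (Fin n → ℤ) := Fintype.piFinset fun _ => Finset.Ico (0 : ℤ) H
  let E : (Fin n → ℤ) → ℂ := fun u => ∑ h ∈ hbox, ee (∑ i, h i * L u i)
  have hEbig : ∀ p ∈ latSet L X Y, ((H : ℝ) / 2) ^ n ≤ ‖E p.1‖ := by
    intro p hp
    rw [mem_latSet] at hp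
    simp only [E, hbox]
    rw [ee_sum_mul_sum, norm_prod]
    calc ((H : ℝ) / 2) ^ n = ∏ _i : Fin n, (H : ℝ) / 2 := by
          rw [Finset.prod_const, Finset.card_univ, Fintype.card_fin]
      _ ≤ _ := Finset.prod_le_prod (fun _ _ => by positivity)
        fun i _ => half_le_norm_sum_ee hHY (hp.2 i)
  -- Since `2Y < 1`, the integer vector `m` is determined by `u`.
  have hinj : Set.InjOn Prod.fst (latSet L X Y : Set ((Fin n → ℤ) × (Fin n → ℤ))) := by
    rintro ⟨u, m⟩ hp ⟨u', m'⟩ hp' h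
    rw [Finset.mem_coe, mem_latSet] at hp hp'
    simp only at h hp hp'
    subst h
    congr 1
    ext i
    have h1 := abs_le.1 (hp.2 i)
    have h2 := abs_le.1 (hp'.2 i)
    have hY : 2 * Y < 1 := by nlinarith
    have h3 : |((m i - m' i : ℤ) : ℝ)| < 1 := by
      push_cast; rw [abs_lt]; constructor <;> linarith
    have h4 : |m i - m' i| < 1 := by exact_mod_cast h3
    have := Int.abs_lt_one_iff.1 h4
    omega
  have h1 : ((latSet L X Y).card : ℝ) * (((H : ℝ) / 2) ^ n) ^ 2 ≤ ∑ u ∈ ibox n X, ‖E u‖ ^ 2 := by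
    calc ((latSet L X Y).card : ℝ) * (((H : ℝ) / 2) ^ n) ^ 2
        = ∑ p ∈ latSet L X Y, (((H : ℝ) / 2) ^ n) ^ 2 := by simp
      _ ≤ ∑ p ∈ latSet L X Y, ‖E p.1‖ ^ 2 := Finset.sum_le_sum fun p hp =>
          pow_le_pow_left₀ (by positivity) (hEbig p hp) 2
      _ = ∑ u ∈ (latSet L X Y).image Prod.fst, ‖E u‖ ^ 2 := by rw [Finset.sum_image hinj]
      _ ≤ _ := Finset.sum_le_sum_of_subset_of_nonneg (by
          intro u hu
          obtain ⟨p, hp, rfl⟩ := Finset.mem_image.1 hu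
          exact mem_ibox.2 (mem_latSet.1 hp).1) fun _ _ _ => by positivity
  have h2 : ((∑ u ∈ ibox n X, ‖E u‖ ^ 2 : ℝ) : ℂ) = ∑ h' ∈ hbox, ∑ h ∈ hbox,
      ∑ u ∈ ibox n X, ee (∑ i, u i * L (h - h') i) := by
    push_cast
    calc ∑ u ∈ ibox n X, ((‖E u‖ : ℂ)) ^ 2
        = ∑ u ∈ ibox n X, ∑ h' ∈ hbox, ∑ h ∈ hbox, ee (∑ i, u i * L (h - h') i) := by
          refine Finset.sum_congr rfl fun u _ => ?_
          rw [← Complex.conj_mul', map_sum, Finset.sum_mul]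
          refine Finset.sum_congr rfl fun h' _ => ?_
          rw [Finset.mul_sum]
          refine Finset.sum_congr rfl fun h _ => ?_
          rw [conj_ee, ← ee_add, ← hL u (h - h')]
          congr 1
          simp only [Pi.sub_apply, Int.cast_sub, sub_mul, Finset.sum_sub_distrib]
          ring
      _ = _ := by
          rw [Finset.sum_comm]
          exact Finset.sum_congr rfl fun h' _ => Finset.sum_comm
  have h3 : ∀ h h' : Fin n → ℤ, ‖∑ u ∈ ibox n X, ee (∑ i, u i * L (h - h') i)‖ ≤
      ∏ i, wt Q (cell Q (L (h - h') i)) := by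
    intro h h'
    unfold ibox
    rw [ee_sum_mul_sum, norm_prod]
    refine Finset.prod_le_prod (fun _ _ => norm_nonneg _) fun i _ => norm_sum_Icc_ee_le hQ1 ?_ _
    have : (⌊X⌋ : ℝ) ≤ X := Int.floor_le X
    have : (⌊X⌋ : ℝ) + 1 - -⌊X⌋ ≤ Q := by linarith
    exact_mod_cast this
  have h4 : ∀ h' ∈ hbox, ∑ h ∈ hbox, ∏ i, wt Q (cell Q (L (h - h') i)) ≤
      (2 * Q * (1 + Real.log Q)) ^ n * (latSet L (2 * H) (1 / Q)).card := by
    intro h' hh'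
    refine le_trans ?_ (sum_prod_wt_le hQ1 (H : ℝ))
    rw [← Finset.sum_image (s := hbox) (g := fun h => h - h')
      (f := fun g => ∏ i, wt Q (cell Q (L g i))) (fun a _ b _ hab => sub_left_injective hab)]
    refine Finset.sum_le_sum_of_subset_of_nonneg ?_ fun g _ _ =>
      Finset.prod_nonneg fun i _ => wt_nonneg (cell_lt hQ1 _)
    intro g hg
    obtain ⟨h, hh, rfl⟩ := Finset.mem_image.1 hg
    rw [mem_ibox]
    intro i
    have a1 := Finset.mem_Ico.1 (Fintype.mem_piFinset.1 hh i)
    have a2 := Finset.mem_Ico.1 (Fintype.mem_piFinset.1 hh' i)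
    have : |(h - h') i| ≤ (H : ℤ) := by rw [Pi.sub_apply, abs_le]; constructor <;> omega
    exact_mod_cast this
  have h5 : ∑ u ∈ ibox n X, ‖E u‖ ^ 2 ≤
      (H : ℝ) ^ n * ((2 * Q * (1 + Real.log Q)) ^ n * (latSet L (2 * H) (1 / Q)).card) := by
    have hnn : 0 ≤ ∑ u ∈ ibox n X, ‖E u‖ ^ 2 := Finset.sum_nonneg fun _ _ => by positivity
    rw [← Complex.norm_of_nonneg hnn, h2]
    calc _ ≤ ∑ h' ∈ hbox, ((2 * Q * (1 + Real.log Q)) ^ n *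
          ((latSet L (2 * H) (1 / Q)).card : ℝ)) := norm_sum_le_of_le _ fun h' hh' =>
            (norm_sum_le_of_le _ fun h _ => h3 h h').trans (h4 h' hh')
      _ = _ := by simp [hbox]
  have h6 := h1.trans h5
  rw [← pow_mul, mul_comm n 2, pow_mul] at h6
  have hpos : 0 < (((H : ℝ) / 2) ^ 2) ^ n := by positivity
  rw [← le_div_iff₀ hpos] at h6
  refine h6.trans (le_of_eq ?_)
  rw [← mul_assoc, ← mul_pow, mul_div_right_comm, ← div_pow]
  congr 2
  field_simp
  ring

set_option maxHeartbeats 1000000 in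
-- Duality bounds the count `N₀` by `c₁ Na`, with `Na` the count in the dual box, and bounds the
-- count `Nd` in a dilated dual box by `c₂ N₁`, with `N₁` the shrunken count. Log-convexity gives
-- `Na N₀ ≤ N₁ Nd`. Multiplying, `N₀² ≤ c₁ c₂ N₁²`; the factors `XY` in `c₁` and `1/(XY)` in `c₂`
-- cancel.
theorem card_latSet_shrink (hL : SymmForms L) {X Y Z l : ℝ} (hY : 0 < Y) (hZ0 : 0 < Z)
    (hZ : Z ≤ 1) (hXY : X * Y ≤ 1) (hZX : 33 ≤ Z * X) (hl : 1 + Real.log (5 / (Z * Y)) ≤ l) :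
    ((latSet L X Y).card : ℝ) ≤ (1300 * l / Z) ^ n * (latSet L (Z * X) (Z * Y)).card := by
  have hX : 33 ≤ X := by nlinarith
  have hX0 : 0 < X := by linarith
  have hXiY : X ≤ 1 / Y := (le_div_iff₀ hY).2 hXY
  have hYiX : Y ≤ 1 / X := (le_div_iff₀ hX0).2 (by linarith)
  set y := 1 / Y with hy
  have hyY : y * Y = 1 := by rw [hy]; field_simp
  have hy33 : 33 ≤ y := hX.trans hXiY
  set r := 1 / Z with hr
  have hrZ : r * Z = 1 := by rw [hr]; field_simp
  have hr1 : 1 ≤ r := (le_div_iff₀ hZ0).2 (by linarith)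
  set M := y * r with hM
  have hMy : y ≤ M := by nlinarith
  have hM0 : 0 < M := by linarith
  have h5M : 5 / (Z * Y) = 5 * M := by rw [hM, hy, hr]; field_simp
  rw [h5M] at hl
  have hl1 : 1 ≤ l := le_trans (by linarith [Real.log_nonneg (x := 5 * M) (by linarith)]) hl
  set H := ⌊y / 13⌋₊
  have hHle : (H : ℝ) ≤ y / 13 := Nat.floor_le (by linarith)
  have hHge : y / 26 ≤ H := by
    have := Nat.lt_floor_add_one (y / 13)
    have h1 : 1 ≤ H := Nat.le_floor (by push_cast; linarith)
    have h2 : (1 : ℝ) ≤ H := by exact_mod_cast h1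
    linarith
  have hH1 : 1 ≤ H := Nat.le_floor (by push_cast; linarith)
  set Q := ⌈2 * X + 1⌉₊
  have hQge : 2 * X + 1 ≤ Q := Nat.le_ceil _
  have hQle : (Q : ℝ) ≤ 3 * X := by
    have := Nat.ceil_lt_add_one (a := 2 * X + 1) (by linarith)
    linarith
  set k := ⌈2 * r⌉₊
  have hkge : 2 * r ≤ k := Nat.le_ceil _
  have hkle : (k : ℝ) ≤ 3 * r := by
    have := Nat.ceil_lt_add_one (a := 2 * r) (by linarith)
    linarith
  have hk1 : 1 ≤ k := by
    have : (1 : ℝ) ≤ k := by linarith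
    exact_mod_cast this
  -- The tolerance of the dilated box is at most `5/(2ZX)`, and `13 · (5/2) < 33`.
  set H' := ⌊Z * X / 33⌋₊
  have hHle' : (H' : ℝ) ≤ Z * X / 33 := Nat.floor_le (by linarith)
  have hH1' : 1 ≤ H' := Nat.le_floor (by push_cast; linarith)
  have hHge' : Z * X / 66 ≤ H' := by
    have := Nat.lt_floor_add_one (Z * X / 33)
    have h2 : (1 : ℝ) ≤ H' := by exact_mod_cast hH1'
    linarith
  set Q' := ⌈4 * M⌉₊
  have hQge' : 4 * M ≤ Q' := Nat.le_ceil _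
  have hQle' : (Q' : ℝ) ≤ 5 * M := by
    have := Nat.ceil_lt_add_one (a := 4 * M) (by linarith)
    linarith
  have hQ0 : (0 : ℝ) < Q := by linarith
  have hQ0' : (0 : ℝ) < Q' := by linarith
  have hlogQ : 1 + Real.log Q ≤ l := by
    have := Real.log_le_log hQ0 (show (Q : ℝ) ≤ 5 * M by linarith)
    linarith
  have hlogQ' : 1 + Real.log Q' ≤ l := by
    have := Real.log_le_log hQ0' hQle'
    linarith
  have hlogn : 0 ≤ 1 + Real.log Q := by linarith [Real.log_nonneg (x := Q) (by linarith)]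
  have hlogn' : 0 ≤ 1 + Real.log Q' := by linarith [Real.log_nonneg (x := Q') (by linarith)]
  have hH0 : (0 : ℝ) < H := by exact_mod_cast hH1
  have hH0' : (0 : ℝ) < H' := by exact_mod_cast hH1'
  have hXr : X * r ≤ M := by nlinarith
  set N₀ : ℝ := ((latSet L X Y).card : ℝ)
  set N₁ : ℝ := ((latSet L (Z * X) (Z * Y)).card : ℝ)
  set Na : ℝ := ((latSet L (2 * H) (1 / Q)).card : ℝ)
  set Nd : ℝ := ((latSet L (k * (2 * H) + X) (k * (1 / Q) + Y)).card : ℝ)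
  have i1 : N₀ ≤ (8 * (Q * (1 + Real.log Q)) / H) ^ n * Na := by
    refine card_latSet_le_dual hL hX0.le hH1 hQge ?_
    nlinarith
  have i2 : Nd ≤ (8 * (Q' * (1 + Real.log Q')) / H') ^ n * N₁ := by
    have hkH : (k : ℝ) * H ≤ 3 / 13 * M := by
      calc (k : ℝ) * H ≤ (3 * r) * (y / 13) := mul_le_mul hkle hHle hH0.le (by linarith)
        _ = _ := by rw [hM]; ring
    refine (card_latSet_le_dual hL (by positivity) hH1' (Q := Q') ?_ ?_).trans ?_
    · linarith
    · have e1 : (k : ℝ) * (1 / Q) ≤ 3 * r / (2 * X) := by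
        rw [mul_one_div]
        exact div_le_div₀ (by linarith) hkle (by linarith) (by linarith)
      have e2 : Y ≤ r / X := hYiX.trans (div_le_div_of_nonneg_right hr1 hX0.le)
      have e3 : (k : ℝ) * (1 / Q) + Y ≤ 5 / 2 * (r / X) := by
        have : 3 * r / (2 * X) = 3 / 2 * (r / X) := by field_simp
        linarith
      have e4 : 0 ≤ (k : ℝ) * (1 / Q) + Y := by positivity
      calc 13 * (H' : ℝ) * (k * (1 / Q) + Y) ≤ 13 * (Z * X / 33) * (5 / 2 * (r / X)) :=
            mul_le_mul (by linarith) e3 e4 (by positivity)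
        _ = 65 / 66 * (r * Z) := by field_simp; ring
        _ ≤ 1 := by rw [hrZ]; norm_num
    · refine mul_le_mul_of_nonneg_left ?_ (by positivity)
      refine Nat.cast_le.2 (Finset.card_le_card (latSet_mono (by linarith) ?_))
      rw [div_le_iff₀ hQ0']
      have : Z * Y * (4 * M) = 4 * ((r * Z) * (y * Y)) := by rw [hM]; ring
      rw [hrZ, hyY] at this
      have h2 : Z * Y * (4 * M) ≤ Z * Y * Q' := mul_le_mul_of_nonneg_left hQge' (by positivity)
      linarith
  have i3 : Na * N₀ ≤ N₁ * Nd := by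
    have := card_latSet_mul_le (L := L) (X₁ := 2 * H) (Y₁ := 1 / Q) (X₂ := X) (Y₂ := Y)
      (Xc := Z * X) (Yc := Z * Y) hk1 (by
        have : 2 * (r * Z) * X ≤ k * Z * X := by
          have := mul_le_mul_of_nonneg_right hkge (mul_pos hZ0 hX0).le
          linarith
        rw [hrZ] at this; linarith) (by
        have : 2 * (r * Z) * Y ≤ k * Z * Y := by
          have := mul_le_mul_of_nonneg_right hkge (mul_pos hZ0 hY).le
          linarith
        rw [hrZ] at this; linarith) le_rfl le_rfl
    have h2 := (Nat.cast_le (α := ℝ)).2 this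
    rwa [Nat.cast_mul, Nat.cast_mul] at h2
  set c₁ := 8 * (Q * (1 + Real.log Q)) / H
  set c₂ := 8 * (Q' * (1 + Real.log Q')) / H'
  have hc₁ : 0 ≤ c₁ := by positivity
  have hc₂ : 0 ≤ c₂ := by positivity
  have hN₁ : 0 ≤ N₁ := Nat.cast_nonneg _
  have hN₀ : 0 ≤ N₀ := Nat.cast_nonneg _
  have hc : c₁ * c₂ ≤ (1300 * l / Z) ^ 2 := by
    have b1 : c₁ ≤ 624 * (X * Y) * l := by
      rw [div_le_iff₀ hH0]
      have a1 : (Q : ℝ) * (1 + Real.log Q) ≤ 3 * X * l :=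
        mul_le_mul hQle hlogQ hlogn (by linarith)
      have a2 : 624 * (X * Y) * l * (y / 26) ≤ 624 * (X * Y) * l * H :=
        mul_le_mul_of_nonneg_left hHge (by positivity)
      have a3 : 624 * (X * Y) * l * (y / 26) = 24 * X * l * (y * Y) := by ring
      rw [a3, hyY] at a2
      linarith
    have b2 : c₂ ≤ 2640 * (M * r / X) * l := by
      rw [div_le_iff₀ hH0']
      have a1 : (Q' : ℝ) * (1 + Real.log Q') ≤ 5 * M * l :=
        mul_le_mul hQle' hlogQ' hlogn' (by linarith)
      have a2 : 2640 * (M * r / X) * l * (Z * X / 66) ≤ 2640 * (M * r / X) * l * H' :=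
        mul_le_mul_of_nonneg_left hHge' (by positivity)
      have a3 : 2640 * (M * r / X) * l * (Z * X / 66) = 40 * M * l * (r * Z) := by
        field_simp; ring
      rw [a3, hrZ] at a2
      linarith
    calc c₁ * c₂ ≤ (624 * (X * Y) * l) * (2640 * (M * r / X) * l) :=
          mul_le_mul b1 b2 hc₂ (by positivity)
      _ = 1647360 * (y * Y) * (r * l) ^ 2 := by rw [hM]; field_simp; ring
      _ ≤ 1690000 * (r * l) ^ 2 := by
          rw [hyY]; nlinarith [sq_nonneg (r * l)]
      _ = _ := by rw [hr]; ring
  have hsq : N₀ ^ 2 ≤ ((1300 * l / Z) ^ n * N₁) ^ 2 := by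
    calc N₀ ^ 2 = N₀ * N₀ := sq _
      _ ≤ (c₁ ^ n * Na) * N₀ := mul_le_mul_of_nonneg_right i1 hN₀
      _ = c₁ ^ n * (Na * N₀) := by ring
      _ ≤ c₁ ^ n * (N₁ * (c₂ ^ n * N₁)) := mul_le_mul_of_nonneg_left
          (i3.trans (mul_le_mul_of_nonneg_left i2 hN₁)) (by positivity)
      _ = (c₁ * c₂) ^ n * N₁ ^ 2 := by rw [mul_pow]; ring
      _ ≤ ((1300 * l / Z) ^ 2) ^ n * N₁ ^ 2 := mul_le_mul_of_nonneg_right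
          (pow_le_pow_left₀ (mul_nonneg hc₁ hc₂) hc n) (sq_nonneg _)
      _ = _ := by rw [mul_pow, ← pow_mul, ← pow_mul, mul_comm 2 n]
  exact le_of_sq_le_sq hsq (by positivity)

end QuarticWeyl
end


noncomputable section

namespace QuarticWeyl

open MvPolynomial

/-! ### Weyl differencing -/

/-- The box of integer vectors between `a` and `b`. -/
def zbox {n : ℕ} (a b : Fin n → ℤ) : Finset (Fin n → ℤ) :=
  Fintype.piFinset fun i => Finset.Icc (a i) (b i)

lemma mem_zbox {n : ℕ} {a b u : Fin n → ℤ} : u ∈ zbox a b ↔ ∀ i, a i ≤ u i ∧ u i ≤ b i := by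
  simp [zbox, Fintype.mem_piFinset]

/-- The exponential sum with phase `φ` over a box. -/
def wsum {n : ℕ} (φ : (Fin n → ℤ) → ℝ) (a b : Fin n → ℤ) : ℂ := ∑ u ∈ zbox a b, ee (φ u)

/-- The difference of `φ` with step `h`. -/
def diff {n : ℕ} {R : Type*} [AddCommGroup R] (h : Fin n → ℤ) (φ : (Fin n → ℤ) → R) :
    (Fin n → ℤ) → R := fun u => φ (u + h) - φ u

variable {n : ℕ}

/-- Expand the square over pairs `u, v` and put `h = v - u`. The `u` with both `u` and `u + h` in
the box again form a box. -/
lemma norm_wsum_sq_le (φ : (Fin n → ℤ) → ℝ) {a b : Fin n → ℤ} {N : ℕ}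
    (hab : ∀ i, b i - a i ≤ N) :
    ‖wsum φ a b‖ ^ 2 ≤ ∑ h ∈ ibox n N, ‖wsum (diff h φ) (a ⊔ (a - h)) (b ⊓ (b - h))‖ := by
  classical
  have hmem : ∀ u h : Fin n → ℤ, u ∈ zbox (a ⊔ (a - h)) (b ⊓ (b - h)) ↔
      u ∈ zbox a b ∧ u + h ∈ zbox a b := by
    intro u h
    simp only [mem_zbox, ← forall_and]
    refine forall_congr' fun i => ?_
    simp only [Pi.sup_apply, Pi.inf_apply, Pi.sub_apply, Pi.add_apply, sup_le_iff, le_inf_iff]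
    omega
  have key : wsum φ a b * (starRingEnd ℂ) (wsum φ a b) =
      ∑ h ∈ ibox n N, wsum (diff h φ) (a ⊔ (a - h)) (b ⊓ (b - h)) := by
    simp only [wsum]
    rw [map_sum, Finset.sum_mul_sum, Finset.sum_comm, ← Finset.sum_product',
      Finset.sum_sigma']
    refine Finset.sum_bij' (fun p _ => ⟨p.2 - p.1, p.1⟩) (fun p _ => (p.2, p.2 + p.1)) ?_ ?_ ?_ ?_ ?_
    · rintro ⟨u, v⟩ huv
      rw [Finset.mem_product] at huv
      simp only [Finset.mem_sigma, hmem]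
      refine ⟨mem_ibox.2 fun i => ?_, huv.1, by simpa using huv.2⟩
      have h1 := mem_zbox.1 huv.1 i
      have h2 := mem_zbox.1 huv.2 i
      have h3 := hab i
      have : |(v - u) i| ≤ (N : ℤ) := by rw [Pi.sub_apply, abs_le]; constructor <;> simp only at * <;> omega
      exact_mod_cast this
    · rintro ⟨h, u⟩ hu
      simp only [Finset.mem_sigma, hmem] at hu
      exact Finset.mem_product.2 hu.2
    · rintro ⟨u, v⟩ _; simp
    · rintro ⟨h, u⟩ _; simp
    · rintro ⟨u, v⟩ _
      simp only [diff]
      rw [conj_ee, ← ee_add, add_sub_cancel, sub_eq_add_neg]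
  calc ‖wsum φ a b‖ ^ 2 = ‖wsum φ a b * (starRingEnd ℂ) (wsum φ a b)‖ := by
        rw [norm_mul, RCLike.norm_conj, sq]
    _ ≤ _ := by rw [key]; exact norm_sum_le _ _

/-- One differencing step and the power mean inequality. The inner box depends on `h`, so `K h` has
to be uniform over all boxes of side at most `N`. -/
lemma norm_wsum_pow_le {φ : (Fin n → ℤ) → ℝ} {N : ℕ} {K : (Fin n → ℤ) → ℝ} (m : ℕ)
    (hK : ∀ h (a b : Fin n → ℤ), (∀ i, b i - a i ≤ N) → ‖wsum (diff h φ) a b‖ ^ (m + 1) ≤ K h)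
    (a b : Fin n → ℤ) (hab : ∀ i, b i - a i ≤ N) :
    ‖wsum φ a b‖ ^ (2 * (m + 1)) ≤ (ibox n N).card ^ m * ∑ h ∈ ibox n N, K h := by
  have hcard : (0 : ℝ) < (ibox n N).card := by
    have : (0 : Fin n → ℤ) ∈ ibox n N := mem_ibox.2 fun i => by simp
    exact_mod_cast Finset.card_pos.2 ⟨0, this⟩
  have h1 := pow_sum_div_card_le_sum_pow (s := ibox n N)
    (f := fun h => ‖wsum (diff h φ) (a ⊔ (a - h)) (b ⊓ (b - h))‖) (fun _ _ => norm_nonneg _) m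
  rw [div_le_iff₀ (by positivity)] at h1
  rw [pow_mul]
  refine (pow_le_pow_left₀ (by positivity) (norm_wsum_sq_le φ hab) _).trans (h1.trans ?_)
  rw [mul_comm]
  refine mul_le_mul_of_nonneg_left (Finset.sum_le_sum fun h _ => hK h _ _ fun i => ?_)
    (by positivity)
  have := hab i
  simp only [Pi.sup_apply, Pi.inf_apply, Pi.sub_apply]
  omega

theorem norm_wsum_pow_eight_le {φ : (Fin n → ℤ) → ℝ} {N : ℕ}
    {K : (Fin n → ℤ) → (Fin n → ℤ) → (Fin n → ℤ) → ℝ}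
    (hK : ∀ x y w (a b : Fin n → ℤ), (∀ i, b i - a i ≤ N) →
      ‖wsum (diff w (diff y (diff x φ))) a b‖ ≤ K x y w)
    (a b : Fin n → ℤ) (hab : ∀ i, b i - a i ≤ N) :
    ‖wsum φ a b‖ ^ 8 ≤ (ibox n N).card ^ 4 *
      ∑ x ∈ ibox n N, ∑ y ∈ ibox n N, ∑ w ∈ ibox n N, K x y w := by
  have h1 : ∀ x y (a b : Fin n → ℤ), (∀ i, b i - a i ≤ N) →
      ‖wsum (diff y (diff x φ)) a b‖ ^ 2 ≤ ∑ w ∈ ibox n N, K x y w := fun x y a b hab => by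
    simpa using norm_wsum_pow_le 0 (K := K x y) (fun w a b hab => by simpa using hK x y w a b hab)
      a b hab
  have h2 : ∀ x (a b : Fin n → ℤ), (∀ i, b i - a i ≤ N) → ‖wsum (diff x φ) a b‖ ^ 4 ≤
      (ibox n N).card * ∑ y ∈ ibox n N, ∑ w ∈ ibox n N, K x y w := fun x a b hab => by
    simpa using norm_wsum_pow_le 1 (h1 x) a b hab
  refine (norm_wsum_pow_le 3 h2 a b hab).trans (le_of_eq ?_)
  rw [← Finset.mul_sum]
  ring

lemma norm_wsum_linear_le {N Q : ℕ} (hQ : N + 1 ≤ Q) (θ : Fin n → ℝ) (c : ℝ) (a b : Fin n → ℤ)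
    (hab : ∀ i, b i - a i ≤ N) :
    ‖wsum (fun u => (∑ i, u i * θ i) + c) a b‖ ≤ ∏ i, wt Q (cell Q (θ i)) := by
  simp only [wsum, ee_add, ← Finset.sum_mul, norm_mul, norm_ee, mul_one]
  unfold zbox
  rw [ee_sum_mul_sum, norm_prod]
  refine Finset.prod_le_prod (fun _ _ => norm_nonneg _) fun i _ =>
    norm_sum_Icc_ee_le (by omega) ?_ _
  have := hab i
  omega

/-! ### Polarization -/

lemma quadrilin_add (F : MvPolynomial (Fin n) ℤ) (x x' y w u : Fin n → ℤ) :
    quadrilin F (x + x') y w u = quadrilin F x y w u + quadrilin F x' y w u := by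
  simp only [quadrilin, ← Finset.sum_add_distrib, Pi.add_apply]
  refine Finset.sum_congr rfl fun i _ => Finset.sum_congr rfl fun j _ =>
    Finset.sum_congr rfl fun k _ => Finset.sum_congr rfl fun l _ => ?_
  ring

lemma quadrilin_swap₁ (F : MvPolynomial (Fin n) ℤ) (x y w u : Fin n → ℤ) :
    quadrilin F x y w u = quadrilin F y x w u := by
  simp only [quadrilin]
  rw [Finset.sum_comm]
  refine Finset.sum_congr rfl fun i _ => Finset.sum_congr rfl fun j _ =>
    Finset.sum_congr rfl fun k _ => Finset.sum_congr rfl fun l _ => ?_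
  rw [tensor_swap₁]; ring

lemma quadrilin_swap₂ (F : MvPolynomial (Fin n) ℤ) (x y w u : Fin n → ℤ) :
    quadrilin F x y w u = quadrilin F x w y u := by
  simp only [quadrilin]
  refine Finset.sum_congr rfl fun i _ => ?_
  rw [Finset.sum_comm]
  refine Finset.sum_congr rfl fun j _ =>
    Finset.sum_congr rfl fun k _ => Finset.sum_congr rfl fun l _ => ?_
  rw [tensor_swap₂]; ring

lemma quadrilin_swap₃ (F : MvPolynomial (Fin n) ℤ) (x y w u : Fin n → ℤ) :
    quadrilin F x y w u = quadrilin F x y u w := by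
  simp only [quadrilin]
  refine Finset.sum_congr rfl fun i _ => Finset.sum_congr rfl fun j _ => ?_
  rw [Finset.sum_comm]
  refine Finset.sum_congr rfl fun k _ => Finset.sum_congr rfl fun l _ => ?_
  rw [tensor_swap₃]; ring

lemma quadrilin_eq_sum (F : MvPolynomial (Fin n) ℤ) (x y w u : Fin n → ℤ) :
    quadrilin F u x y w = ∑ i, u i * trilin F x y w i := by
  simp only [quadrilin, trilin, Finset.mul_sum]
  refine Finset.sum_congr rfl fun i _ => Finset.sum_congr rfl fun j _ =>
    Finset.sum_congr rfl fun k _ => Finset.sum_congr rfl fun l _ => ?_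
  ring

/-- Binomial expansion after sorting arguments by symmetry: each difference lowers the degree in `v`
by one, with leading coefficients `4`, `4·3`, `4·3·2`. The part free of `u` is only a constant phase
later and is kept as the value at `0`. -/
lemma diff_diff_diff_diag {q : (Fin n → ℤ) → (Fin n → ℤ) → (Fin n → ℤ) → (Fin n → ℤ) → ℤ}
    (hadd : ∀ x x' y w u, q (x + x') y w u = q x y w u + q x' y w u)
    (h1 : ∀ x y w u, q x y w u = q y x w u) (h2 : ∀ x y w u, q x y w u = q x w y u)
    (h3 : ∀ x y w u, q x y w u = q x y u w) (x y w u : Fin n → ℤ) :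
    diff w (diff y (diff x fun v => q v v v v)) u =
      24 * q u x y w + diff w (diff y (diff x fun v => q v v v v)) 0 := by
  have add2 : ∀ x y y' w u, q x (y + y') w u = q x y w u + q x y' w u := fun x y y' w u => by
    rw [h1, hadd, h1 y, h1 y']
  have add3 : ∀ x y w w' u, q x y (w + w') u = q x y w u + q x y w' u := fun x y w w' u => by
    rw [h2, add2, h2 x w, h2 x w']
  have add4 : ∀ x y w u u', q x y w (u + u') = q x y w u + q x y w u' := fun x y w u u' => by
    rw [h3, add3, h3 x y u, h3 x y u']
  have z1 : ∀ y w u, q 0 y w u = 0 := fun y w u => by simpa using hadd 0 0 y w u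
  have d1 : ∀ h v, q (v + h) (v + h) (v + h) (v + h) - q v v v v =
      4 * q h v v v + 6 * q h h v v + 4 * q h h h v + q h h h h := fun h v => by
    simp only [hadd, add2, add3, add4]
    rw [h1 v h v v, h2 v v h v, h1 v h v v, h3 v v v h, h2 v v h v, h1 v h v v,
      h2 h v h v, h3 h v v h, h2 h v h v, h1 v h h v, h2 h v h v, h1 v h v h, h3 h v v h, h2 h v h v,
      h3 v v h h, h2 v v h h, h1 v h v h, h3 h v v h, h2 h v h v,
      h3 h h v h, h2 h v h h, h3 h h v h, h1 v h h h, h2 h v h h, h3 h h v h]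
    ring
  have d2 : ∀ g h v, q g (v + h) (v + h) (v + h) - q g v v v =
      3 * q g h v v + 3 * q g h h v + q g h h h := fun g h v => by
    simp only [add2, add3, add4]
    rw [h2 g v h v, h3 g v v h, h2 g v h v, h3 g h v h, h2 g v h h, h3 g h v h]
    ring
  have d3 : ∀ f g h v, q f g (v + h) (v + h) - q f g v v = 2 * q f g h v + q f g h h :=
    fun f g h v => by
    simp only [add3, add4]
    rw [h3 f g v h]
    ring
  have e1 : (diff x fun v => q v v v v) =
      fun v => 4 * q x v v v + 6 * q x x v v + 4 * q x x x v + q x x x x := funext fun v => d1 x v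
  have e2 : diff y (diff x fun v => q v v v v) = fun v => 4 * (3 * q x y v v + 3 * q x y y v +
      q x y y y) + 6 * (2 * q x x y v + q x x y y) + 4 * q x x x y := by
    rw [e1]
    funext v
    have a1 := d2 x y v
    have a2 := d3 x x y v
    simp only [diff]
    rw [add4 x x x]
    linarith
  have e3 : ∀ v, diff w (diff y (diff x fun v => q v v v v)) v =
      4 * (3 * (2 * q x y w v + q x y w w) + 3 * q x y y w) + 12 * q x x y w := by
    intro v
    rw [e2]
    have a1 := d3 x y w v
    simp only [diff]
    rw [add4 x y y, add4 x x y]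
    linarith
  rw [e3, e3]
  have p1 : q x y w u = q u x y w := by rw [h3, h2, h1]
  have p2 : q x y w 0 = 0 := by rw [h3, h2, h1, z1]
  rw [p1, p2]
  ring

/-- The `24` of polarization cancels the `24` in `24 F = quadrilin F x x x x`, leaving integral
coefficients. -/
lemma diff_diff_diff_eval {F : MvPolynomial (Fin n) ℤ} (hF : F.IsHomogeneous 4)
    (x y w u : Fin n → ℤ) :
    diff w (diff y (diff x fun v => eval v F)) u =
      ∑ i, u i * trilin F x y w i + diff w (diff y (diff x fun v => eval v F)) 0 := by
  have h := diff_diff_diff_diag (quadrilin_add F) (quadrilin_swap₁ F) (quadrilin_swap₂ F)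
    (quadrilin_swap₃ F) x y w u
  simp only [← smul_eval_eq_quadrilin hF, quadrilin_eq_sum] at h
  simp only [diff] at h ⊢
  linarith

/-! ### Shrinking all three variables of the trilinear forms -/

lemma diff_mul_cast (α : ℝ) (f : (Fin n → ℤ) → ℤ) (h : Fin n → ℤ) :
    (diff h fun v => α * (f v : ℝ)) = fun v => α * ((diff h f v : ℤ) : ℝ) := by
  funext v; simp only [diff]; push_cast; ring

/-- The linear forms `w ↦ α B(x, y, w)`. -/
def trilinMap (F : MvPolynomial (Fin n) ℤ) (α : ℝ) (x y : Fin n → ℤ) :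
    (Fin n → ℤ) →+ (Fin n → ℝ) where
  toFun w i := α * (trilin F x y w i : ℝ)
  map_zero' := by funext i; simp [trilin]
  map_add' w w' := by
    funext i
    simp only [trilin, Pi.add_apply, ← mul_add, ← Int.cast_add, ← Finset.sum_add_distrib]

lemma trilinMap_apply (F : MvPolynomial (Fin n) ℤ) (α : ℝ) (x y w : Fin n → ℤ) (i : Fin n) :
    trilinMap F α x y w i = α * (trilin F x y w i : ℝ) := rfl

lemma trilin_swap₁ (F : MvPolynomial (Fin n) ℤ) (x y w : Fin n → ℤ) :
    trilin F x y w = trilin F y x w := by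
  funext i
  simp only [trilin]
  rw [Finset.sum_comm]
  refine Finset.sum_congr rfl fun j _ =>
    Finset.sum_congr rfl fun k _ => Finset.sum_congr rfl fun l _ => ?_
  rw [tensor_swap₂]; ring

lemma trilin_swap₂ (F : MvPolynomial (Fin n) ℤ) (x y w : Fin n → ℤ) :
    trilin F x y w = trilin F x w y := by
  funext i
  simp only [trilin]
  refine Finset.sum_congr rfl fun j _ => ?_
  rw [Finset.sum_comm]
  refine Finset.sum_congr rfl fun k _ => Finset.sum_congr rfl fun l _ => ?_
  rw [tensor_swap₃]; ring

lemma symmForms_trilinMap (F : MvPolynomial (Fin n) ℤ) (α : ℝ) (x y : Fin n → ℤ) :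
    SymmForms (trilinMap F α x y) := by
  intro u h
  have key : quadrilin F h x y u = quadrilin F u x y h := by
    rw [quadrilin_swap₁ F h x y u, quadrilin_swap₂ F x h y u, quadrilin_swap₃ F x y h u,
      quadrilin_swap₂ F x y u h, quadrilin_swap₁ F x u y h]
  rw [quadrilin_eq_sum, quadrilin_eq_sum] at key
  have key' := congrArg (fun z : ℤ => α * (z : ℝ)) key
  simp only [Int.cast_sum, Int.cast_mul, Finset.mul_sum] at key'
  simp only [trilinMap_apply]
  refine (Finset.sum_congr rfl fun i _ => ?_).trans (key'.trans (Finset.sum_congr rfl fun i _ => ?_))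
  · ring
  · ring

/-- The number of quadruples `(x, y, w, m)` in boxes with `α B(x, y, w) + m` small. -/
def tripleCount (F : MvPolynomial (Fin n) ℤ) (α X₁ X₂ X₃ Y : ℝ) : ℕ :=
  ∑ x ∈ ibox n X₁, ∑ y ∈ ibox n X₂, ∑ w ∈ ibox n X₃, (near Y (trilinMap F α x y w)).card

lemma tripleCount_eq (F : MvPolynomial (Fin n) ℤ) (α X₁ X₂ X₃ Y : ℝ) :
    tripleCount F α X₁ X₂ X₃ Y =
      ∑ x ∈ ibox n X₁, ∑ y ∈ ibox n X₂, (latSet (trilinMap F α x y) X₃ Y).card := by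
  simp only [tripleCount, card_latSet]

lemma trilinMap_swap₁ (F : MvPolynomial (Fin n) ℤ) (α : ℝ) (x y w : Fin n → ℤ) :
    trilinMap F α x y w = trilinMap F α y x w := by
  funext i; rw [trilinMap_apply, trilinMap_apply, trilin_swap₁]

lemma trilinMap_swap₂ (F : MvPolynomial (Fin n) ℤ) (α : ℝ) (x y w : Fin n → ℤ) :
    trilinMap F α x y w = trilinMap F α x w y := by
  funext i; rw [trilinMap_apply, trilinMap_apply, trilin_swap₂]

lemma tripleCount_swap₁ (F : MvPolynomial (Fin n) ℤ) (α X₁ X₂ X₃ Y : ℝ) :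
    tripleCount F α X₁ X₂ X₃ Y = tripleCount F α X₂ X₁ X₃ Y := by
  unfold tripleCount
  rw [Finset.sum_comm]
  exact Finset.sum_congr rfl fun y _ => Finset.sum_congr rfl fun x _ =>
    Finset.sum_congr rfl fun w _ => by rw [trilinMap_swap₁]

lemma tripleCount_swap₂ (F : MvPolynomial (Fin n) ℤ) (α X₁ X₂ X₃ Y : ℝ) :
    tripleCount F α X₁ X₂ X₃ Y = tripleCount F α X₁ X₃ X₂ Y := by
  unfold tripleCount
  refine Finset.sum_congr rfl fun x _ => ?_
  rw [Finset.sum_comm]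
  exact Finset.sum_congr rfl fun y _ => Finset.sum_congr rfl fun w _ => by rw [trilinMap_swap₂]

lemma tripleCount_shrink (F : MvPolynomial (Fin n) ℤ) (α X₁ X₂ : ℝ) {X Y Z l : ℝ} (hY : 0 < Y)
    (hZ0 : 0 < Z) (hZ : Z ≤ 1) (hXY : X * Y ≤ 1) (hZX : 33 ≤ Z * X)
    (hl : 1 + Real.log (5 / (Z * Y)) ≤ l) :
    (tripleCount F α X₁ X₂ X Y : ℝ) ≤
      (1300 * l / Z) ^ n * tripleCount F α X₁ X₂ (Z * X) (Z * Y) := by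
  simp only [tripleCount_eq, Nat.cast_sum, Finset.mul_sum]
  exact Finset.sum_le_sum fun x _ => Finset.sum_le_sum fun y _ =>
    card_latSet_shrink (symmForms_trilinMap F α x y) hY hZ0 hZ hXY hZX hl

lemma ibox_mono {X X' : ℝ} (h : X ≤ X') : ibox n X ⊆ ibox n X' := fun _ hu =>
  mem_ibox.2 fun i => (mem_ibox.1 hu i).trans h

/-- Shrinking acts on the last variable, and symmetry moves each variable there in turn. With `Z =
W/R` the tolerance runs through `1/R, Z/R, Z²/R, Z³/R = W³/R⁴`. -/
lemma tripleCount_shrink_all (F : MvPolynomial (Fin n) ℤ) (α : ℝ) {R W l : ℝ} (hW : 33 ≤ W)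
    (hWR : W ≤ R) (hl : 1 + Real.log (5 * R ^ 4) ≤ l) :
    (tripleCount F α R R R (1 / R) : ℝ) ≤
      (1300 * l * (R / W)) ^ (3 * n) * tripleCount F α W W W (W ^ 3 / R ^ 4) := by
  have hR : 0 < R := by linarith
  have hR1 : 1 ≤ R := by linarith
  have hW0 : 0 < W := by linarith
  set Z := W / R with hZ
  have hZ0 : 0 < Z := div_pos hW0 hR
  have hZ1 : Z ≤ 1 := (div_le_one hR).2 hWR
  have hZR : Z * R = W := div_mul_cancel₀ _ hR.ne'
  have hRZ : 1 ≤ Z * R := by rw [hZR]; linarith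
  have hl' : ∀ k : ℕ, k ≤ 3 → 1 + Real.log (5 / (Z ^ k * (1 / R))) ≤ l := by
    intro k hk
    refine le_trans ?_ hl
    have : 5 / (Z ^ k * (1 / R)) ≤ 5 * R ^ 4 := by
      rw [div_le_iff₀ (by positivity)]
      have h1 : R ^ 4 * (Z ^ k * (1 / R)) = R ^ 3 * Z ^ k := by field_simp
      have h2 : Z ^ 3 ≤ Z ^ k := pow_le_pow_of_le_one hZ0.le hZ1 hk
      have h3 : 1 ≤ R ^ 3 * Z ^ 3 := by
        rw [← mul_pow, mul_comm R Z]; exact one_le_pow₀ hRZ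
      have h4 : R ^ 3 * Z ^ 3 ≤ R ^ 3 * Z ^ k := mul_le_mul_of_nonneg_left h2 (by positivity)
      calc (5 : ℝ) ≤ 5 * (R ^ 4 * (Z ^ k * (1 / R))) := by rw [h1]; linarith
        _ = _ := by ring
    have := Real.log_le_log (by positivity) this
    linarith
  have hZle : ∀ k : ℕ, R * (Z ^ k * (1 / R)) ≤ 1 := fun k => by
    have : R * (Z ^ k * (1 / R)) = Z ^ k := by field_simp
    rw [this]; exact pow_le_one₀ hZ0.le hZ1
  have hstep : ∀ (X₁ X₂ : ℝ) (k : ℕ), k < 3 → (tripleCount F α X₁ X₂ R (Z ^ k * (1 / R)) : ℝ) ≤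
      (1300 * l * (R / W)) ^ n * tripleCount F α X₁ X₂ W (Z ^ (k + 1) * (1 / R)) := by
    intro X₁ X₂ k hk
    have hlk := hl' (k + 1) hk
    have e : Z * (Z ^ k * (1 / R)) = Z ^ (k + 1) * (1 / R) := by ring
    have := tripleCount_shrink F α X₁ X₂ (X := R) (Y := Z ^ k * (1 / R)) (Z := Z) (l := l)
      (by positivity) hZ0 hZ1 (hZle k) (by rw [hZR]; exact hW) (by rw [e]; exact hlk)
    rw [hZR, e] at this
    convert this using 3
    rw [hZ]; field_simp
  have s0 := hstep R R 0 (by norm_num)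
  have s1 := hstep R W 1 (by norm_num)
  have s2 := hstep W W 2 (by norm_num)
  rw [pow_zero, one_mul, zero_add, tripleCount_swap₂ F α R R W] at s0
  rw [tripleCount_swap₁ F α R W W, tripleCount_swap₂ F α W R W] at s1
  have hl1 : 0 ≤ l := by
    have := Real.log_nonneg (x := 5 * R ^ 4) (by nlinarith [one_le_pow₀ (n := 4) hR1])
    linarith
  have hc : 0 ≤ (1300 * l * (R / W)) ^ n := by positivity
  have e : W ^ 3 / R ^ 4 = Z ^ 3 * (1 / R) := by rw [hZ]; field_simp
  rw [e, pow_mul', pow_succ, pow_two, mul_assoc, mul_assoc]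
  exact s0.trans (mul_le_mul_of_nonneg_left (s1.trans (mul_le_mul_of_nonneg_left s2 hc)) hc)

/-- Cells of width `1/(2N)` produce lattice points of size `2N`. The ranges of `x` and `y` are
enlarged from `N` to `2N` so that the three variables are interchangeable. -/
theorem norm_wsum_pow_eight_le_tripleCount {F : MvPolynomial (Fin n) ℤ} (hF : F.IsHomogeneous 4)
    (α : ℝ) {N : ℕ} (hN : 1 ≤ N) {W l : ℝ} (hW : 33 ≤ W) (hWN : W ≤ 2 * N)
    (hl : 1 + Real.log (5 * (2 * N) ^ 4) ≤ l) (a b : Fin n → ℤ) (hab : ∀ i, b i - a i ≤ N) :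
    ‖wsum (fun u => α * (eval u F : ℤ)) a b‖ ^ 8 ≤ (((4 * N : ℝ)) ^ n) ^ 4 *
      ((4 * N * l) ^ n * ((1300 * l * (2 * N / W)) ^ (3 * n) *
        tripleCount F α W W W (W ^ 3 / (2 * N) ^ 4))) := by
  have hN1 : (1 : ℝ) ≤ N := by exact_mod_cast hN
  have hN0 : (0 : ℝ) < N := by linarith
  have h1 := norm_wsum_pow_eight_le (φ := fun u => α * (eval u F : ℤ)) (N := N)
    (K := fun x y w => ∏ i, wt (2 * N) (cell (2 * N) (trilinMap F α x y w i))) (by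
      intro x y w a b hab
      have e : diff w (diff y (diff x fun u => α * ((eval u F : ℤ) : ℝ))) = fun u =>
          (∑ i, u i * trilinMap F α x y w i) +
            α * ((diff w (diff y (diff x fun v => eval v F)) 0 : ℤ) : ℝ) := by
        rw [diff_mul_cast, diff_mul_cast, diff_mul_cast]
        funext u
        rw [diff_diff_diff_eval hF]
        push_cast
        rw [mul_add, Finset.mul_sum]
        congr 1
        refine Finset.sum_congr rfl fun i _ => ?_
        rw [trilinMap_apply]; ring
      rw [e]
      exact norm_wsum_linear_le (by omega) _ _ a b hab) a b hab
  refine h1.trans ?_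
  have hcard : ((ibox n N).card : ℝ) ≤ (4 * N : ℝ) ^ n := by
    have : (ibox n N).card = (2 * N + 1) ^ n := by
      simp only [ibox, Int.floor_natCast, Fintype.card_piFinset, Int.card_Icc, Finset.prod_const,
        Finset.card_univ, Fintype.card_fin]
      congr 1
      omega
    rw [this]
    push_cast
    exact pow_le_pow_left₀ (by positivity) (by linarith) _
  have hlog : 1 + Real.log ((2 * N : ℕ) : ℝ) ≤ l := by
    have h2 : ((2 * N : ℕ) : ℝ) ≤ 5 * (2 * N) ^ 4 := by
      push_cast
      nlinarith [one_le_pow₀ (n := 3) (show (1 : ℝ) ≤ 2 * N by linarith)]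
    have := Real.log_le_log (by push_cast; positivity) h2
    linarith
  have hlog0 : 0 ≤ 1 + Real.log ((2 * N : ℕ) : ℝ) := by
    have := Real.log_nonneg (x := ((2 * N : ℕ) : ℝ)) (by push_cast; linarith)
    linarith
  have hsum : ∑ x ∈ ibox n N, ∑ y ∈ ibox n N, ∑ w ∈ ibox n N,
      ∏ i, wt (2 * N) (cell (2 * N) (trilinMap F α x y w i)) ≤
      (4 * N * l) ^ n * tripleCount F α (2 * N) (2 * N) (2 * N) (1 / (2 * N)) := by
    rw [tripleCount_eq]
    push_cast
    rw [Finset.mul_sum]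
    have hsub : ibox n (N : ℝ) ⊆ ibox n (2 * N) := ibox_mono (by linarith)
    have hin : ∀ x y, ∑ w ∈ ibox n N,
        ∏ i, wt (2 * N) (cell (2 * N) (trilinMap F α x y w i)) ≤
        (4 * N * l) ^ n * (latSet (trilinMap F α x y) (2 * N) (1 / (2 * N))).card := by
      intro x y
      refine (sum_prod_wt_le (by omega) _).trans ?_
      push_cast at hlog hlog0 ⊢
      refine mul_le_mul_of_nonneg_right (pow_le_pow_left₀ (by positivity) ?_ _) (by positivity)
      nlinarith
    have hnn : ∀ x y, 0 ≤ (4 * N * l) ^ n *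
        ((latSet (trilinMap F α x y) (2 * N) (1 / (2 * N))).card : ℝ) := fun x y => by
      have : 0 ≤ l := hlog0.trans hlog
      positivity
    refine (Finset.sum_le_sum fun x _ => (Finset.sum_le_sum fun y _ => hin x y).trans
      (Finset.sum_le_sum_of_subset_of_nonneg hsub fun y _ _ => hnn x y)).trans ?_
    refine (Finset.sum_le_sum_of_subset_of_nonneg hsub fun x _ _ =>
      Finset.sum_nonneg fun y _ => hnn x y).trans (le_of_eq ?_)
    exact Finset.sum_congr rfl fun x _ => (Finset.mul_sum _ _ _).symm
  have hl0 : 0 ≤ l := hlog0.trans hlog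
  refine mul_le_mul (pow_le_pow_left₀ (by positivity) hcard 4) (hsum.trans ?_) ?_ (by positivity)
  · exact mul_le_mul_of_nonneg_left (tripleCount_shrink_all F α hW hWN hl) (by positivity)
  · exact Finset.sum_nonneg fun x _ => Finset.sum_nonneg fun y _ => Finset.sum_nonneg fun w _ =>
      Finset.prod_nonneg fun i _ => wt_nonneg (cell_lt (by omega) _)

end QuarticWeyl
end


noncomputable section

namespace QuarticWeyl

open MvPolynomial

/-! ### The bound for sums over boxes -/

variable {n : ℕ}

lemma exists_abs_trilin_le (F : MvPolynomial (Fin n) ℤ) : ∃ A : ℝ, 0 ≤ A ∧ ∀ (W : ℝ), 0 ≤ W →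
    ∀ x ∈ ibox n W, ∀ y ∈ ibox n W, ∀ w ∈ ibox n W, ∀ i,
      |(trilin F x y w i : ℝ)| ≤ A * W ^ 3 := by
  refine ⟨∑ i, ∑ j, ∑ k, ∑ l, |(tensor F i j k l : ℝ)|, Finset.sum_nonneg fun _ _ =>
    Finset.sum_nonneg fun _ _ => Finset.sum_nonneg fun _ _ => Finset.sum_nonneg fun _ _ =>
    abs_nonneg _, fun W hW x hx y hy w hw i => ?_⟩
  rw [mem_ibox] at hx hy hw
  have h1 : |(trilin F x y w i : ℝ)| ≤ (∑ j, ∑ k, ∑ l, |(tensor F i j k l : ℝ)|) * W ^ 3 := by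
    simp only [trilin, Int.cast_sum, Finset.sum_mul]
    refine (Finset.abs_sum_le_sum_abs _ _).trans (Finset.sum_le_sum fun j _ => ?_)
    refine (Finset.abs_sum_le_sum_abs _ _).trans (Finset.sum_le_sum fun k _ => ?_)
    refine (Finset.abs_sum_le_sum_abs _ _).trans (Finset.sum_le_sum fun l _ => ?_)
    push_cast
    rw [abs_mul, abs_mul, abs_mul]
    refine mul_le_mul_of_nonneg_left ?_ (abs_nonneg _)
    calc |(x j : ℝ)| * |(y k : ℝ)| * |(w l : ℝ)| ≤ W * W * W :=
          mul_le_mul (mul_le_mul (hx j) (hy k) (abs_nonneg _) hW) (hw l) (abs_nonneg _)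
            (mul_nonneg hW hW)
      _ = W ^ 3 := by ring
  refine h1.trans (mul_le_mul_of_nonneg_right ?_ (by positivity))
  exact Finset.single_le_sum (f := fun i => ∑ j, ∑ k, ∑ l, |(tensor F i j k l : ℝ)|)
    (fun _ _ => Finset.sum_nonneg fun _ _ => Finset.sum_nonneg fun _ _ =>
      Finset.sum_nonneg fun _ _ => abs_nonneg _) (Finset.mem_univ i)

/-- The integer `aB + mq` is less than `1` in modulus, so it vanishes and `q ∣ B`. What remains of
`αB + m` is `Bz`, so `|B||z| ≤ δ < q|z|` gives `|B| < q` and `B = 0`. -/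
lemma eq_zero_of_near_int {a m B : ℤ} {q : ℕ} {z δ : ℝ} (hq : 1 ≤ q) (haq : IsCoprime a (q : ℤ))
    (h1 : |((a : ℝ) / q + z) * B + m| ≤ δ) (h2 : q * (|(B : ℝ)| * |z| + δ) < 1)
    (h3 : δ < q * |z|) : B = 0 ∧ m = 0 := by
  have hq0 : (0 : ℝ) < q := by exact_mod_cast hq
  have e : ((a * B + m * q : ℤ) : ℝ) = q * ((((a : ℝ) / q + z) * B + m) - B * z) := by
    push_cast; field_simp; ring
  have h4 : |((a * B + m * q : ℤ) : ℝ)| < 1 := by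
    rw [e, abs_mul, abs_of_pos hq0]
    refine lt_of_le_of_lt (mul_le_mul_of_nonneg_left ((abs_sub _ _).trans ?_) hq0.le) h2
    rw [abs_mul]; linarith
  have h5 : a * B + m * q = 0 := Int.abs_lt_one_iff.1 (by exact_mod_cast h4)
  have h6 : (q : ℤ) ∣ B := haq.symm.dvd_of_dvd_mul_left ⟨-m, by linarith⟩
  have h7 : ((a : ℝ) / q + z) * B + m = B * z := by
    have := e
    rw [h5] at this
    push_cast at this
    have := (mul_eq_zero.1 this.symm).resolve_left hq0.ne'
    linarith
  rw [h7, abs_mul] at h1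
  have hz : 0 < |z| := by
    have := (abs_nonneg (B : ℝ)); 
    by_contra hz
    have hz0 : |z| = 0 := le_antisymm (not_lt.1 hz) (abs_nonneg z)
    rw [hz0] at h1 h3
    linarith
  have h8 : |(B : ℝ)| < q := lt_of_mul_lt_mul_right (lt_of_le_of_lt h1 h3) hz.le
  have h9 : |B| < (q : ℤ) := by exact_mod_cast h8
  have hB : B = 0 := Int.eq_zero_of_abs_lt_dvd h6 h9
  refine ⟨hB, ?_⟩
  rw [hB, mul_zero, zero_add] at h5
  exact (mul_eq_zero.1 h5).resolve_right (by exact_mod_cast hq0.ne')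

lemma tripleCount_le_card_trilinZeros (F : MvPolynomial (Fin n) ℤ) {a : ℤ} {q : ℕ} {z δ W A : ℝ}
    (hq : 1 ≤ q) (haq : IsCoprime a (q : ℤ))
    (hA : ∀ x ∈ ibox n W, ∀ y ∈ ibox n W, ∀ w ∈ ibox n W, ∀ i,
      |(trilin F x y w i : ℝ)| ≤ A * W ^ 3)
    (h2 : q * (A * W ^ 3 * |z| + δ) < 1) (h3 : δ < q * |z|) :
    tripleCount F ((a : ℝ) / q + z) W W W δ ≤ (trilinZeros F W).card := by
  classical
  have hq0 : (0 : ℝ) ≤ q := Nat.cast_nonneg _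
  have key : ∀ x ∈ ibox n W, ∀ y ∈ ibox n W, ∀ w ∈ ibox n W,
      (near δ (trilinMap F ((a : ℝ) / q + z) x y w)).card ≤
        if trilin F x y w = 0 then 1 else 0 := by
    intro x hx y hy w hw
    have h : ∀ m ∈ near δ (trilinMap F ((a : ℝ) / q + z) x y w), ∀ i,
        trilin F x y w i = 0 ∧ m i = 0 := by
      intro m hm i
      have h1 := mem_near.1 hm i
      rw [trilinMap_apply] at h1
      refine eq_zero_of_near_int hq haq h1 (lt_of_le_of_lt ?_ h2) h3
      exact mul_le_mul_of_nonneg_left (by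
        linarith [mul_le_mul_of_nonneg_right (hA x hx y hy w hw i) (abs_nonneg z)]) hq0
    split_ifs with h0
    · refine Finset.card_le_one.2 fun m hm m' hm' => funext fun i => ?_
      rw [(h m hm i).2, (h m' hm' i).2]
    · rw [Nat.le_zero, Finset.card_eq_zero, Finset.eq_empty_iff_forall_notMem]
      exact fun m hm => h0 (funext fun i => (h m hm i).1)
  unfold tripleCount trilinZeros
  rw [Finset.card_filter, Finset.sum_product]
  refine Finset.sum_le_sum fun x hx => ?_
  rw [Finset.sum_product]
  exact Finset.sum_le_sum fun y hy => Finset.sum_le_sum fun w hw => key x hx y hy w hw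

lemma exists_log_le (B : ℝ) (hB : 1 ≤ B) {δ : ℝ} (hδ : 0 < δ) : ∃ C : ℝ, 1 ≤ C ∧
    ∀ (P : ℝ) (N : ℕ), 1 ≤ P → 1 ≤ N → N ≤ B * P →
      1 + Real.log (5 * (2 * N) ^ 4) ≤ C * P ^ δ := by
  have hlog0 : 0 ≤ Real.log (5 * (2 * B) ^ 4) := Real.log_nonneg (by
    nlinarith [one_le_pow₀ (n := 4) (show (1 : ℝ) ≤ 2 * B by linarith)])
  refine ⟨1 + Real.log (5 * (2 * B) ^ 4) + 4 / δ, by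
    have : 0 < 4 / δ := by positivity
    linarith, fun P N hP hN hNP => ?_⟩
  have hN1 : (1 : ℝ) ≤ N := by exact_mod_cast hN
  have hP0 : 0 < P := by linarith
  have h1 : Real.log (5 * (2 * N) ^ 4) ≤ Real.log (5 * (2 * B) ^ 4 * P ^ 4) := by
    refine Real.log_le_log (by positivity) ?_
    rw [mul_assoc, ← mul_pow]
    exact mul_le_mul_of_nonneg_left (pow_le_pow_left₀ (by positivity) (by linarith) _) (by norm_num)
  have h0 : Real.log (5 * (2 * B) ^ 4 * P ^ 4) = Real.log (5 * (2 * B) ^ 4) + 4 * Real.log P := by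
    rw [Real.log_mul (by positivity) (by positivity), Real.log_pow]; norm_num
  rw [h0] at h1
  have h2 := Real.log_le_rpow_div hP0.le hδ
  have h3 : 1 ≤ P ^ δ := Real.one_le_rpow hP hδ.le
  have h4 : 4 / δ * P ^ δ = 4 * (P ^ δ / δ) := by ring
  nlinarith

lemma norm_wsum_le_card (φ : (Fin n → ℤ) → ℝ) {N : ℕ} {b₁ b₂ : Fin n → ℤ}
    (hb : ∀ i, b₂ i - b₁ i ≤ N) : ‖wsum φ b₁ b₂‖ ≤ ((N : ℝ) + 1) ^ n := by
  refine (norm_sum_le _ _).trans ?_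
  simp only [norm_ee, Finset.sum_const, nsmul_eq_mul, mul_one, zbox, Fintype.card_piFinset,
    Int.card_Icc]
  push_cast
  calc ∏ i, ((b₂ i + 1 - b₁ i).toNat : ℝ) ≤ ∏ _i : Fin n, ((N : ℝ) + 1) :=
        Finset.prod_le_prod (fun _ _ => by positivity) fun i _ => by
          have h3 : (b₂ i + 1 - b₁ i).toNat ≤ N + 1 := by have := hb i; omega
          exact_mod_cast h3
    _ = _ := by rw [Finset.prod_const, Finset.card_univ, Fintype.card_fin]

lemma exists_cube_mul_eq {T κ : ℝ} (hT : 0 < T) (hκ : 0 < κ) : ∃ W : ℝ, 0 < W ∧ W ^ 3 * T = κ :=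
  ⟨(κ / T) ^ (1 / 3 : ℝ), by positivity, by
    rw [← Real.rpow_natCast, ← Real.rpow_mul (by positivity)]
    norm_num
    field_simp⟩

lemma inv_pow_eq_of_cube {T κ W : ℝ} (hT : 0 < T) (hκ : 0 < κ) (hW : 0 < W) (h : W ^ 3 * T = κ)
    (D : ℕ) : W⁻¹ ^ D = (1 / κ) ^ ((D : ℝ) / 3) * T ^ ((D : ℝ) / 3) := by
  have h1 : 1 / κ * T = W⁻¹ ^ (3 : ℝ) := by
    rw [show (3 : ℝ) = ((3 : ℕ) : ℝ) by norm_num, Real.rpow_natCast, ← h]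
    field_simp
  rw [← Real.mul_rpow (by positivity) hT.le, h1, ← Real.rpow_mul (by positivity),
    ← Real.rpow_natCast]
  congr 1
  ring

lemma le_of_pow_eight_le {S C P T ε e : ℝ} {n : ℕ} (hC : 0 ≤ C) (hP : 0 < P) (hT : 0 ≤ T)
    (h : S ^ 8 ≤ C * P ^ (8 * n) * P ^ (8 * ε) * T ^ (8 * e)) :
    S ≤ C ^ (1 / 8 : ℝ) * P ^ ((n : ℝ) + ε) * T ^ e := by
  refine le_of_pow_le_pow_left₀ (n := 8) (by norm_num) (by positivity) (h.trans (le_of_eq ?_))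
  have e1 : (C ^ (1 / 8 : ℝ)) ^ 8 = C := by
    rw [← Real.rpow_natCast, ← Real.rpow_mul hC]; norm_num
  have e2 : (T ^ e) ^ 8 = T ^ (8 * e) := by
    rw [← Real.rpow_natCast, ← Real.rpow_mul hT, mul_comm]; norm_num
  have e3 : (P ^ ε) ^ 8 = P ^ (8 * ε) := by
    rw [← Real.rpow_natCast, ← Real.rpow_mul hP.le, mul_comm]; norm_num
  rw [mul_pow, mul_pow, e1, e2, Real.rpow_add hP, Real.rpow_natCast, mul_pow, e3, ← pow_mul,
    mul_comm n 8, mul_assoc C]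

lemma collect_powers {N l W C : ℝ} (hW : 0 < W) {n s D : ℕ} (hD : n = s + D) :
    ((4 * N) ^ n) ^ 4 * ((4 * N * l) ^ n * ((1300 * l * (2 * N / W)) ^ (3 * n) *
      (C * W ^ (2 * n + s)))) =
    4 ^ (5 * n) * 2600 ^ (3 * n) * C * N ^ (8 * n) * l ^ (4 * n) * W⁻¹ ^ D := by
  have e1 : 1300 * l * (2 * N / W) = 2600 * l * N * W⁻¹ := by field_simp; ring
  have e2 : W⁻¹ ^ (3 * n) * W ^ (2 * n + s) = W⁻¹ ^ D := by
    rw [show 3 * n = D + (2 * n + s) by omega, pow_add, mul_assoc, ← mul_pow,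
      inv_mul_cancel₀ hW.ne', one_pow, mul_one]
  rw [e1, ← e2]
  simp only [mul_pow, ← pow_mul]
  ring

/-- The choice of the shrinking scale `W` in terms of `u = q|z|`. -/
lemma scale_bounds {u T P κ W : ℝ} (hP : 1 ≤ P) (hu : 0 < u) (hκ : κ ≤ 1)
    (hT : T = u + 1 / (u * P ^ 4)) (hW : 0 < W) (h : W ^ 3 * T = κ) :
    W ≤ P ∧ W ^ 3 * u ≤ κ ∧ W ^ 3 ≤ κ * u * P ^ 4 := by
  have hP0 : 0 < P := by linarith
  have huT : u ≤ T := by rw [hT]; linarith [show 0 < 1 / (u * P ^ 4) by positivity]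
  have hT0 : 0 < T := hu.trans_le huT
  have huT' : 1 ≤ T * (u * P ^ 4) := by
    rw [hT, add_mul, one_div, inv_mul_cancel₀ (by positivity)]
    linarith [show 0 < u * (u * P ^ 4) by positivity]
  have hW3 : 0 < W ^ 3 := by positivity
  refine ⟨?_, ?_, ?_⟩
  -- `T` dominates both `u` and `1/(uP⁴)`, whose product is `P⁻⁴`.
  · have hTP : 1 ≤ T * P ^ 2 := by
      by_contra! h
      have h1 : u * P ^ 2 < 1 := lt_of_le_of_lt (mul_le_mul_of_nonneg_right huT (by positivity)) h
      have h2 : (T * P ^ 2) * (u * P ^ 2) < 1 :=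
        mul_lt_one_of_nonneg_of_lt_one_left (by positivity) h h1.le
      have h3 : (T * P ^ 2) * (u * P ^ 2) = T * (u * P ^ 4) := by ring
      linarith
    refine le_of_not_gt fun hlt => ?_
    have h1 : P ^ 3 < W ^ 3 := pow_lt_pow_left₀ hlt hP0.le (by norm_num)
    have h2 : W ^ 3 * (T * P ^ 2) = κ * P ^ 2 := by rw [← h]; ring
    have h3 : W ^ 3 ≤ W ^ 3 * (T * P ^ 2) := le_mul_of_one_le_right hW3.le hTP
    have h4 : P ^ 2 ≤ P ^ 3 := pow_le_pow_right₀ hP (by norm_num)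
    have h5 : κ * P ^ 2 ≤ 1 * P ^ 2 := mul_le_mul_of_nonneg_right hκ (by positivity)
    linarith
  · rw [← h]; exact mul_le_mul_of_nonneg_left huT hW3.le
  · calc W ^ 3 = W ^ 3 * 1 := by ring
      _ ≤ W ^ 3 * (T * (u * P ^ 4)) := mul_le_mul_of_nonneg_left huT' hW3.le
      _ = κ * u * P ^ 4 := by rw [← h]; ring

/-- The hypothesis `|z| ≤ q⁻²` enters as `q · q|z| ≤ 1`. With `u = q|z|`, the bound on `W³u`
controls the error `Bz`, and the bound on `W³/(uP⁴)` controls the tolerance. -/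
lemma tripleCount_scale_le {F : MvPolynomial (Fin n) ℤ} {A : ℝ}
    (hA0 : 0 ≤ A) (hA : ∀ (W : ℝ), 0 ≤ W →
      ∀ x ∈ ibox n W, ∀ y ∈ ibox n W, ∀ w ∈ ibox n W, ∀ i,
        |(trilin F x y w i : ℝ)| ≤ A * W ^ 3)
    {a : ℤ} {q : ℕ} {z W κ P R : ℝ} (hq : 1 ≤ q) (haq : IsCoprime a (q : ℤ))
    (hz : z ≠ 0) (hzq : |z| ≤ 1 / (q : ℝ) ^ 2) (hκ0 : 0 < κ) (hκA : (A + 1) * κ = 1 / 4)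
    (hP : 0 < P) (hPR : P ≤ R) (hW0 : 0 < W)
    (h1 : W ^ 3 * (q * |z|) ≤ κ) (h2 : W ^ 3 ≤ κ * (q * |z|) * P ^ 4) :
    tripleCount F ((a : ℝ) / q + z) W W W (W ^ 3 / R ^ 4) ≤ (trilinZeros F W).card := by
  have hq0 : (0 : ℝ) < q := by exact_mod_cast hq
  have hz0 : 0 < |z| := abs_pos.2 hz
  have hqu : q * (q * |z|) ≤ 1 := by
    rw [le_div_iff₀ (by positivity)] at hzq
    linarith
  have hR : 0 < R := hP.trans_le hPR
  have hδW : W ^ 3 / R ^ 4 ≤ κ * (q * |z|) := by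
    rw [div_le_iff₀ (by positivity)]
    exact h2.trans (mul_le_mul_of_nonneg_left (pow_le_pow_left₀ hP.le hPR 4) (by positivity))
  refine tripleCount_le_card_trilinZeros F hq haq (hA W hW0.le) ?_ ?_
  · calc q * (A * W ^ 3 * |z| + W ^ 3 / R ^ 4)
        ≤ q * (A * W ^ 3 * |z| + κ * (q * |z|)) :=
          mul_le_mul_of_nonneg_left (by linarith) hq0.le
      _ = A * (W ^ 3 * (q * |z|)) + κ * (q * (q * |z|)) := by ring
      _ ≤ A * κ + κ * 1 := add_le_add (mul_le_mul_of_nonneg_left h1 hA0)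
          (mul_le_mul_of_nonneg_left hqu hκ0.le)
      _ = 1 / 4 := by linarith
      _ < 1 := by norm_num
  · refine lt_of_le_of_lt hδW ?_
    have hκ1 : κ < 1 := by nlinarith
    have : 0 < q * |z| := by positivity
    nlinarith

/-- Weyl's inequality for sums over boxes. -/
theorem exists_norm_wsum_le {F : MvPolynomial (Fin n) ℤ} (hF : F.IsHomogeneous 4) {B ε : ℝ}
    (hB : 1 ≤ B) (hε : 0 < ε) :
    ∃ C : ℝ, 0 < C ∧
      ∀ (P : ℝ) (N : ℕ), 1 ≤ P → P ≤ N → N ≤ B * P →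
      ∀ (a : ℤ) (q : ℕ) (z : ℝ), 1 ≤ q → IsCoprime a (q : ℤ) →
        z ≠ 0 → |z| ≤ 1 / (q : ℝ) ^ 2 →
      ∀ b₁ b₂ : Fin n → ℤ, (∀ i, b₂ i - b₁ i ≤ N) →
        ‖wsum (fun u => ((a : ℝ) / q + z) * (eval u F : ℤ)) b₁ b₂‖ ≤ C * P ^ ((n : ℝ) + ε) *
          ((q : ℝ) * |z| + (q : ℝ)⁻¹ * |z|⁻¹ * (P ^ 4)⁻¹) ^
              (((n : ℝ) - (sigma F : ℝ) - 1) / 24) := by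
  obtain ⟨s, hs, hsn, C₂, hC₂, hcount⟩ := exists_card_trilinZeros_le hF
  obtain ⟨A, hA0, hA⟩ := exists_abs_trilin_le F
  obtain ⟨D, hD⟩ := Nat.exists_eq_add_of_le hsn
  have hexp : ((n : ℝ) - sigma F - 1) / 24 = D / 24 := by
    have h1 : (sigma F : ℝ) = s - 1 := by
      have : ((s : ℤ) : ℝ) = ((sigma F + 1 : ℤ) : ℝ) := by rw [hs]
      push_cast at this; linarith
    have h2 : (n : ℝ) = s + D := by rw [hD]; push_cast; ring
    rw [h1, h2]; ring
  rw [hexp]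
  -- The logarithms occur to the power `4n`, and `4nδ ≤ 8ε`; the denominator `n + 1` also allows `n
  -- = 0`.
  obtain ⟨δ, hδ⟩ : ∃ δ, δ = ε / (n + 1) := ⟨_, rfl⟩
  have hδ0 : 0 < δ := by rw [hδ]; positivity
  obtain ⟨C₃, hC₃, hlog⟩ := exists_log_le B hB hδ0
  obtain ⟨κ, hκ⟩ : ∃ κ, κ = 1 / (4 * (A + 1)) := ⟨_, rfl⟩
  have hκ0 : 0 < κ := by rw [hκ]; positivity
  have hκA : (A + 1) * κ = 1 / 4 := by rw [hκ]; field_simp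
  have hκ1 : κ ≤ 1 := by nlinarith
  obtain ⟨C₄, hC₄⟩ : ∃ C₄, C₄ = 4 ^ (5 * n) * 2600 ^ (3 * n) * C₂ * B ^ (8 * n) *
    C₃ ^ (4 * n) * (1 / κ) ^ ((D : ℝ) / 3) := ⟨_, rfl⟩
  have hC₄0 : 0 < C₄ := by rw [hC₄]; positivity
  obtain ⟨C₁, hC₁⟩ : ∃ C₁, C₁ = (2 * B) ^ n * (33 ^ 3 / κ) ^ ((D : ℝ) / 24) := ⟨_, rfl⟩
  have hC₁0 : 0 < C₁ := by rw [hC₁]; positivity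
  have hC₅0 : 0 < C₄ ^ (1 / 8 : ℝ) := by positivity
  refine ⟨C₄ ^ (1 / 8 : ℝ) + C₁, by positivity, ?_⟩
  intro P N hP hPN hNP a q z hq haq hz hzq b₁ b₂ hb
  have hP0 : 0 < P := by linarith
  have hN1' : 1 ≤ N := by exact_mod_cast hP.trans hPN
  have hN0 : (0 : ℝ) < N := by linarith
  have hq0 : (0 : ℝ) < q := by exact_mod_cast hq
  have hz0 : 0 < |z| := abs_pos.2 hz
  have hu0 : 0 < (q : ℝ) * |z| := by positivity
  obtain ⟨T, hT⟩ : ∃ T, T = (q : ℝ) * |z| + (q : ℝ)⁻¹ * |z|⁻¹ * (P ^ 4)⁻¹ := ⟨_, rfl⟩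
  have hT' : T = (q : ℝ) * |z| + 1 / ((q : ℝ) * |z| * P ^ 4) := by rw [hT]; field_simp
  have hT0 : 0 < T := by rw [hT']; positivity
  rw [← hT]
  obtain ⟨W, hW0, hW3⟩ := exists_cube_mul_eq hT0 hκ0
  obtain ⟨hWP, hWu, hWu'⟩ := scale_bounds hP hu0 hκ1 hT' hW0 hW3
  have hTD : 0 < T ^ ((D : ℝ) / 24) := Real.rpow_pos_of_pos hT0 _
  have hPm0 : 0 < P ^ ((n : ℝ) + ε) := Real.rpow_pos_of_pos hP0 _
  -- If `W < 33` then `T` is bounded below and the trivial bound suffices; otherwise shrinking is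
  -- allowed.
  rcases lt_or_ge W 33 with hlt | hge
  · have h1 := norm_wsum_le_card (fun u => ((a : ℝ) / q + z) * (eval u F : ℤ)) hb
    have h2 : 1 ≤ (33 ^ 3 / κ) ^ ((D : ℝ) / 24) * T ^ ((D : ℝ) / 24) := by
      rw [← Real.mul_rpow (by positivity) hT0.le]
      refine Real.one_le_rpow ?_ (by positivity)
      rw [div_mul_eq_mul_div, one_le_div hκ0, ← hW3]
      exact mul_le_mul_of_nonneg_right (pow_le_pow_left₀ hW0.le hlt.le 3) hT0.le
    have h3 : ((N : ℝ) + 1) ^ n ≤ (2 * B) ^ n * P ^ ((n : ℝ) + ε) := by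
      calc ((N : ℝ) + 1) ^ n ≤ (2 * B * P) ^ n :=
            pow_le_pow_left₀ (by positivity) (by linarith) _
        _ = (2 * B) ^ n * P ^ (n : ℝ) := by rw [mul_pow, Real.rpow_natCast]
        _ ≤ _ := mul_le_mul_of_nonneg_left
            (Real.rpow_le_rpow_of_exponent_le hP (by linarith)) (by positivity)
    calc _ ≤ (2 * B) ^ n * P ^ ((n : ℝ) + ε) * 1 := by rw [mul_one]; exact h1.trans h3
      _ ≤ (2 * B) ^ n * P ^ ((n : ℝ) + ε) *
          ((33 ^ 3 / κ) ^ ((D : ℝ) / 24) * T ^ ((D : ℝ) / 24)) :=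
          mul_le_mul_of_nonneg_left h2 (by positivity)
      _ = C₁ * P ^ ((n : ℝ) + ε) * T ^ ((D : ℝ) / 24) := by rw [hC₁]; ring
      _ ≤ (C₄ ^ (1 / 8 : ℝ) + C₁) * P ^ ((n : ℝ) + ε) * T ^ ((D : ℝ) / 24) :=
          mul_le_mul_of_nonneg_right (mul_le_mul_of_nonneg_right (by linarith) hPm0.le) hTD.le
  · have hlogl := hlog P N hP hN1' hNP
    obtain ⟨l, hl⟩ : ∃ l, l = C₃ * P ^ δ := ⟨_, rfl⟩
    rw [← hl] at hlogl
    have hl0 : 0 < l := by rw [hl]; positivity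
    have h1 := norm_wsum_pow_eight_le_tripleCount hF ((a : ℝ) / q + z) hN1' hge
      (by linarith) hlogl b₁ b₂ hb
    have h2 := tripleCount_scale_le hA0 hA hq haq hz hzq hκ0 hκA hP0 (R := 2 * N) (by linarith)
      hW0 hWu hWu'
    have h3 := ((Nat.cast_le (α := ℝ)).2 h2).trans (hcount W (by linarith))
    have h4 := h1.trans (mul_le_mul_of_nonneg_left (mul_le_mul_of_nonneg_left
      (mul_le_mul_of_nonneg_left h3 (by positivity)) (by positivity)) (by positivity))
    rw [collect_powers hW0 hD, inv_pow_eq_of_cube hT0 hκ0 hW0 hW3] at h4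
    have h5 : l ^ (4 * n) ≤ C₃ ^ (4 * n) * P ^ (8 * ε) := by
      rw [hl, mul_pow]
      refine mul_le_mul_of_nonneg_left ?_ (by positivity)
      rw [← Real.rpow_natCast, ← Real.rpow_mul hP0.le]
      refine Real.rpow_le_rpow_of_exponent_le hP ?_
      have h6 : δ * (n + 1) = ε := by rw [hδ]; field_simp
      have h7 : 0 ≤ δ * n := by positivity
      push_cast
      linarith
    have h6 : (N : ℝ) ^ (8 * n) ≤ B ^ (8 * n) * P ^ (8 * n) := by
      rw [← mul_pow]; exact pow_le_pow_left₀ hN0.le hNP _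
    have hκD : 0 < (1 / κ) ^ ((D : ℝ) / 3) := Real.rpow_pos_of_pos (by positivity) _
    have hTD3 : 0 < T ^ ((D : ℝ) / 3) := Real.rpow_pos_of_pos hT0 _
    refine (le_of_pow_eight_le (C := C₄) (P := P) (T := T) (ε := ε) (e := (D : ℝ) / 24) (n := n)
      hC₄0.le hP0 hT0.le ?_).trans
      (mul_le_mul_of_nonneg_right (mul_le_mul_of_nonneg_right (by linarith) hPm0.le) hTD.le)
    refine h4.trans ?_
    calc _ ≤ 4 ^ (5 * n) * 2600 ^ (3 * n) * C₂ * (B ^ (8 * n) * P ^ (8 * n)) *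
          (C₃ ^ (4 * n) * P ^ (8 * ε)) * ((1 / κ) ^ ((D : ℝ) / 3) * T ^ ((D : ℝ) / 3)) := by
          refine mul_le_mul_of_nonneg_right ?_ (mul_pos hκD hTD3).le
          refine mul_le_mul ?_ h5 (pow_pos hl0 _).le (by positivity)
          exact mul_le_mul_of_nonneg_left h6 (by positivity)
      _ = C₄ * P ^ (8 * n) * P ^ (8 * ε) * T ^ ((D : ℝ) / 3) := by rw [hC₄]; ring
      _ = _ := by rw [show (D : ℝ) / 3 = 8 * (D / 24) by ring]

end QuarticWeyl
end


noncomputable section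

namespace QuarticWeyl

open MvPolynomial

/-! ### Smooth weights: summation by parts -/

variable {n : ℕ}

/-- The mixed difference of `v` in the directions of the list `l`. -/
def listDiff (l : List (Fin n)) (v : (Fin n → ℤ) → ℝ) : (Fin n → ℤ) → ℝ :=
  l.foldl (fun f i => diff (Pi.single i 1) f) v

lemma listDiff_cons (i : Fin n) (l : List (Fin n)) (v : (Fin n → ℤ) → ℝ) :
    listDiff (i :: l) v = listDiff l (diff (Pi.single i 1) v) := rfl

/-- Freezing one coordinate commutes with differencing in the others. -/
lemma listDiff_update {i : Fin n} (s : ℤ) : ∀ {l : List (Fin n)}, i ∉ l →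
    ∀ (v : (Fin n → ℤ) → ℝ) (x : Fin n → ℤ),
      listDiff l (fun x => v (Function.update x i s)) x = listDiff l v (Function.update x i s) := by
  intro l
  induction l with
  | nil => intro _ v x; rfl
  | cons j l ih =>
    intro hi v x
    rw [List.mem_cons, not_or] at hi
    rw [listDiff_cons, listDiff_cons, ← ih hi.2]
    congr 1
    funext y
    simp only [diff]
    congr 2
    funext k
    rcases eq_or_ne k i with rfl | hk
    · simp [Pi.single_eq_of_ne hi.1]
    · simp [Function.update_of_ne hk]

lemma eq_const_of_update {v : (Fin n → ℤ) → ℝ}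
    (h : ∀ j x t, v (Function.update x j t) = v x) (x : Fin n → ℤ) : v x = v 0 := by
  classical
  have : ∀ s : Finset (Fin n), v (s.piecewise x 0) = v 0 := by
    intro s
    induction s using Finset.induction_on with
    | empty => simp
    | insert j s _ ih => rw [Finset.piecewise_insert, h, ih]
  simpa using this Finset.univ

lemma telescope_update {v : (Fin n → ℤ) → ℝ} {K : ℤ} {i : Fin n} {x : Fin n → ℤ}
    (h : v (Function.update x i (K + 1)) = 0) (hx : x i ≤ K) :
    v x = -∑ s ∈ Finset.Icc (x i) K, diff (Pi.single i 1) v (Function.update x i s) := by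
  have key : ∀ m : ℤ, m ≤ K → v (Function.update x i m) =
      -∑ s ∈ Finset.Icc m K, diff (Pi.single i 1) v (Function.update x i s) := by
    intro m hm
    induction m, hm using Int.leInductionDown with
    | base =>
      rw [Finset.Icc_self, Finset.sum_singleton, diff]
      have : Function.update x i K + Pi.single i 1 = Function.update x i (K + 1) := by
        funext k
        rcases eq_or_ne k i with rfl | hk
        · simp
        · simp [hk]
      rw [this, h]; ring
    | pred m hm ih =>
      have e1 : Finset.Icc (m - 1) K = insert (m - 1) (Finset.Icc m K) := by
        ext u; simp only [Finset.mem_Icc, Finset.mem_insert]; omega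
      have e2 : Function.update x i (m - 1) + Pi.single i 1 = Function.update x i m := by
        funext k
        rcases eq_or_ne k i with rfl | hk
        · simp
        · simp [hk]
      rw [e1, Finset.sum_insert (by simp), neg_add, ← ih, diff, e2]
      ring
  simpa using key (x i) hx

/-- Summation by parts in several variables. -/
lemma norm_sum_mul_ee_le {φ : (Fin n → ℤ) → ℝ} {K : ℕ} {M D : ℝ}
    (hM : ∀ a b : Fin n → ℤ, (∀ i, b i - a i ≤ 2 * (K : ℤ)) → ‖wsum φ a b‖ ≤ M) (hD : 0 ≤ D) :
    ∀ (l : List (Fin n)), l.Nodup → ∀ (v : (Fin n → ℤ) → ℝ),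
      (∀ j ∈ l, ∀ x : Fin n → ℤ, x j = K + 1 → v x = 0) →
      (∀ j ∉ l, ∀ x t, v (Function.update x j t) = v x) →
      (∀ x, |listDiff l v x| ≤ D) →
      ∀ a b : Fin n → ℤ, (∀ i, -(K : ℤ) ≤ a i) → (∀ i, b i ≤ K) →
        ‖∑ x ∈ zbox a b, (v x : ℂ) * ee (φ x)‖ ≤ (2 * K + 1) ^ l.length * (D * M) := by
  classical
  intro l
  induction l with
  | nil =>
    intro _ v _ h2 h3 a b ha hb
    have hv : ∀ x, v x = v 0 := eq_const_of_update fun j x t => h2 j (by simp) x t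
    have : ∑ x ∈ zbox a b, (v x : ℂ) * ee (φ x) = v 0 * wsum φ a b := by
      rw [wsum, Finset.mul_sum]
      exact Finset.sum_congr rfl fun x _ => by rw [hv x]
    rw [this, norm_mul, Complex.norm_real, Real.norm_eq_abs, List.length_nil, pow_zero, one_mul]
    refine mul_le_mul (h3 0) (hM a b fun i => ?_) (norm_nonneg _) hD
    have := ha i; have := hb i; omega
  | cons i l ih =>
    intro hl v h1 h2 h3 a b ha hb
    rw [List.nodup_cons] at hl
    -- As `v` vanishes at `x i = K + 1`, it telescopes to `-∑ g s x` over `x i ≤ s ≤ K`. After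
    -- interchanging sums, the condition `x i ≤ s` only truncates the box, and `g s` no longer
    -- depends on coordinate `i`, so the induction continues on the shorter list.
    let g : ℤ → (Fin n → ℤ) → ℝ := fun s x =>
      diff (Pi.single i 1) v (Function.update x i s)
    have hg : ∀ x ∈ zbox a b, (v x : ℂ) * ee (φ x) =
        -∑ s ∈ Finset.Icc (-(K : ℤ)) K, if x i ≤ s then (g s x : ℂ) * ee (φ x) else 0 := by
      intro x hx
      rw [mem_zbox] at hx
      have hxi := hx i; have hai := ha i; have hbi := hb i
      rw [telescope_update (i := i) (K := K) (h1 i (by simp) _ (by simp)) (by omega)]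
      push_cast
      rw [neg_mul, Finset.sum_mul, ← Finset.sum_filter]
      congr 1
      refine Finset.sum_congr ?_ fun s _ => rfl
      ext s
      simp only [Finset.mem_Icc, Finset.mem_filter]
      omega
    have hsub : ∀ s, (zbox a b).filter (fun x => x i ≤ s) =
        zbox a (Function.update b i (min (b i) s)) := by
      intro s
      ext x
      simp only [Finset.mem_filter, mem_zbox]
      constructor
      · rintro ⟨h, hs⟩ k
        rcases eq_or_ne k i with rfl | hk
        · simp [h k, hs]
        · simpa [hk] using h k
      · intro h
        have hi := h i
        simp only [Function.update_self, le_min_iff] at hi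
        refine ⟨fun k => ?_, hi.2.2⟩
        rcases eq_or_ne k i with rfl | hk
        · exact ⟨hi.1, hi.2.1⟩
        · simpa [hk] using h k
    rw [Finset.sum_congr rfl hg, Finset.sum_neg_distrib, norm_neg, Finset.sum_comm]
    have hbound : ∀ s ∈ Finset.Icc (-(K : ℤ)) K,
        ‖∑ x ∈ zbox a b, if x i ≤ s then (g s x : ℂ) * ee (φ x) else 0‖ ≤
          (2 * K + 1) ^ l.length * (D * M) := by
      intro s _
      rw [← Finset.sum_filter, hsub]
      refine ih hl.2 (g s) ?_ ?_ ?_ a _ ha ?_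
      · intro j hj x hxj
        have hji : j ≠ i := fun h => hl.1 (h ▸ hj)
        have e1 := h1 j (List.mem_cons_of_mem _ hj) (Function.update x i s + Pi.single i 1)
          (by simp [hji, hxj])
        have e2 := h1 j (List.mem_cons_of_mem _ hj) (Function.update x i s) (by simp [hji, hxj])
        simp only [g, diff, e1, e2, sub_zero]
      · intro j hj x t
        rcases eq_or_ne j i with rfl | hji
        · simp only [g, Function.update_idem]
        · have hj' : j ∉ i :: l := by simp [hji, hj]
          have e : Function.update (Function.update x j t) i s =
            Function.update (Function.update x i s) j t := Function.update_comm hji _ _ _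
          have e' : Function.update (Function.update x i s) j t + Pi.single i 1 =
              Function.update (Function.update x i s + Pi.single i 1) j t := by
            funext k
            rcases eq_or_ne k j with rfl | hk
            · simp [hji]
            · simp [hk]
          simp only [g, diff, e, e', h2 j hj']
      · intro x
        simp only [g]
        rw [listDiff_update s hl.1]
        exact h3 _
      · intro k
        rcases eq_or_ne k i with rfl | hk
        · simp [hb k]
        · simpa [hk] using hb k
    refine (norm_sum_le_of_le _ hbound).trans (le_of_eq ?_)
    rw [Finset.sum_const, Int.card_Icc, nsmul_eq_mul, List.length_cons, pow_succ]
    have : (((K : ℤ) + 1 - -(K : ℤ)).toNat : ℝ) = 2 * K + 1 := by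
      have : ((K : ℤ) + 1 - -(K : ℤ)).toNat = 2 * K + 1 := by omega
      rw [this]; push_cast; rfl
    rw [this]
    ring

/-- The mixed difference of a function on `ℝⁿ` in the directions of a list of vectors. -/
def realDiff (l : List (Fin n → ℝ)) (f : (Fin n → ℝ) → ℝ) : (Fin n → ℝ) → ℝ :=
  l.foldl (fun f h x => f (x + h) - f x) f

/-- Each difference is traded for a derivative by the mean value inequality on the segment from `y`
to `y + h`. -/
lemma abs_realDiff_le {B : ℝ} : ∀ (l : List (Fin n → ℝ)) (f : (Fin n → ℝ) → ℝ),
    ContDiff ℝ (⊤ : ℕ∞) f → (∀ x, |iteratedFDeriv ℝ l.length f x l.get| ≤ B) →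
    ∀ x, |realDiff l f x| ≤ B := by
  intro l
  induction l with
  | nil => intro f _ h x; simpa [realDiff] using h x
  | cons h l ih =>
    intro f hf hB x
    have hshift : ContDiff ℝ (⊤ : ℕ∞) fun y => f (y + h) := hf.comp (contDiff_id.add contDiff_const)
    refine ih (fun y => f (y + h) - f y) (hshift.sub hf) (fun y => ?_) x
    set k := l.length
    have hk : ∀ {g : (Fin n → ℝ) → ℝ}, ContDiff ℝ (⊤ : ℕ∞) g → ContDiff ℝ k g := fun hg =>
      hg.of_le (by exact_mod_cast le_top)
    have e1 : iteratedFDeriv ℝ k (fun y => f (y + h) - f y) y =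
        iteratedFDeriv ℝ k f (y + h) - iteratedFDeriv ℝ k f y := by
      rw [← iteratedFDeriv_comp_add_right]
      exact congrFun (iteratedFDeriv_sub (hk hshift) (hk hf)) y
    rw [e1]
    let γ : ℝ → ℝ := fun t => iteratedFDeriv ℝ k f (y + t • h) l.get
    have hγ : ∀ t, HasDerivAt γ (iteratedFDeriv ℝ (k + 1) f (y + t • h) (h :: l).get) t := by
      intro t
      have hd : DifferentiableAt ℝ (iteratedFDeriv ℝ k f) (y + t • h) :=
        (hf.differentiable_iteratedFDeriv (m := k) (by exact_mod_cast WithTop.coe_lt_top _)) _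
      have hline : HasDerivAt (fun t : ℝ => y + t • h) h t := by
        simpa using ((hasDerivAt_id t).smul_const h).const_add y
      have h1 := hd.hasFDerivAt.comp_hasDerivAt t hline
      have h2 := (ContinuousMultilinearMap.apply ℝ (fun _ : Fin k => Fin n → ℝ) ℝ
        l.get).hasFDerivAt.comp_hasDerivAt t h1
      exact h2
    have hbd := norm_image_sub_le_of_norm_deriv_le_segment_01' (f := γ) (C := B)
      (fun t _ => (hγ t).hasDerivWithinAt) (fun t _ => hB (y + t • h))
    simpa [γ] using hbd

lemma listDiff_comp (l : List (Fin n)) (P : ℝ) : ∀ (f : (Fin n → ℝ) → ℝ) (x : Fin n → ℤ),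
    listDiff l (fun x => f fun i => (x i : ℝ) / P) x =
      realDiff (l.map fun i => Pi.single i (1 / P)) f fun i => (x i : ℝ) / P := by
  induction l with
  | nil => intro f x; rfl
  | cons j l ih =>
    intro f x
    rw [listDiff_cons, List.map_cons]
    change _ = realDiff (l.map fun i => Pi.single i (1 / P))
      (fun y => f (y + Pi.single j (1 / P)) - f y) _
    rw [← ih]
    congr 1
    funext y
    simp only [diff]
    congr 2
    funext k
    rcases eq_or_ne k j with rfl | hk
    · simp [add_div]
    · simp [hk]

lemma abs_listDiff_le {ω : (Fin n → ℝ) → ℝ} (hω : ContDiff ℝ (⊤ : ℕ∞) ω) {B P : ℝ} (hP : 0 < P)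
    (hB : ∀ (k : Fin n → Fin n) (x : Fin n → ℝ),
      |iteratedFDeriv ℝ n ω x (fun l => Pi.single (k l) (1 : ℝ))| ≤ B) (x : Fin n → ℤ) :
    |listDiff (List.finRange n) (fun x => ω fun i => (x i : ℝ) / P) x| ≤ B / P ^ n := by
  rw [listDiff_comp]
  refine abs_realDiff_le _ ω hω (fun y => ?_) _
  have key : ∀ (m : ℕ) (g : Fin m → (Fin n → ℝ)), m = n →
      (∀ j, ∃ i, g j = Pi.single i (1 / P)) → |iteratedFDeriv ℝ m ω y g| ≤ B / P ^ n := by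
    rintro m g rfl hg
    choose k hk using hg
    have e : g = fun j => (1 / P) • (Pi.single (k j) (1 : ℝ) : Fin m → ℝ) := by
      funext j
      rw [hk, ← Pi.single_smul, smul_eq_mul, mul_one]
    rw [e, ContinuousMultilinearMap.map_smul_univ]
    simp only [Finset.prod_const, Finset.card_univ, Fintype.card_fin, smul_eq_mul, abs_mul]
    rw [abs_of_pos (by positivity), div_pow, one_pow, one_div_mul_eq_div]
    exact div_le_div_of_nonneg_right (hB k y) (by positivity)
  refine key _ _ (by simp) fun j => ?_
  simp only [List.get_eq_getElem, List.getElem_map]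
  exact ⟨_, rfl⟩

end QuarticWeyl
end


noncomputable section

namespace QuarticWeyl

open MvPolynomial

/-! ### From box sums to weighted exponential sums -/

variable {n : ℕ}

lemma expSum_eq_sum {F : MvPolynomial (Fin n) ℤ} {ω : (Fin n → ℝ) → ℝ} {P : ℝ}
    {a b : Fin n → ℤ} (h : ∀ x ∉ zbox a b, ω (fun i => (x i : ℝ) / P) = 0) (α : ℝ) :
    expSum F ω P α =
      ∑ x ∈ zbox a b, (ω (fun i => (x i : ℝ) / P) : ℂ) * ee (α * (eval x F : ℤ)) := by
  rw [expSum, tsum_eq_sum (s := zbox a b) fun x hx => by rw [h x hx]; simp]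
  refine Finset.sum_congr rfl fun x _ => ?_
  rw [ee]
  push_cast
  congr 2
  ring

lemma expSum_boxWeight (F : MvPolynomial (Fin n) ℤ) {P : ℝ} (hP : 0 < P) (α : ℝ) :
    expSum F (boxWeight n) P α =
      wsum (fun x => α * (eval x F : ℤ)) (fun _ => 1) fun _ => ⌊P⌋ := by
  have hmem : ∀ x : Fin n → ℤ, x ∈ zbox (fun _ => 1) (fun _ => ⌊P⌋) ↔
      (fun i => (x i : ℝ) / P) ∈ {x : Fin n → ℝ | ∀ i, 0 < x i ∧ x i ≤ 1} := by
    intro x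
    rw [mem_zbox]
    refine forall_congr' fun i => ?_
    rw [div_pos_iff_of_pos_right hP, div_le_one hP, Int.le_floor, Int.cast_pos]
    exact Iff.rfl
  rw [expSum_eq_sum (a := fun _ => 1) (b := fun _ => ⌊P⌋), wsum]
  · refine Finset.sum_congr rfl fun x hx => ?_
    rw [boxWeight, Set.indicator_of_mem ((hmem x).1 hx)]
    simp
  · intro x hx
    rw [boxWeight, Set.indicator_of_notMem fun h => hx ((hmem x).2 h)]

/-- The mixed difference of `ω(x/P)` in all `n` directions is `O(P⁻ⁿ)`, which offsets the `(2K +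
1)^n` from summation by parts when `K ≍ P`. Only the derivative bound of order `n` matters. -/
lemma norm_expSum_le_of_mem_weightClass (F : MvPolynomial (Fin n) ℤ) {c : ℝ} {cj : ℕ → ℝ}
    {ω : (Fin n → ℝ) → ℝ} (hω : ω ∈ weightClass n c cj) {P α M : ℝ} (hP : 0 < P) {K : ℕ}
    (hK : |c| * P ≤ K)
    (hM : ∀ a b : Fin n → ℤ, (∀ i, b i - a i ≤ 2 * (K : ℤ)) →
      ‖wsum (fun x => α * (eval x F : ℤ)) a b‖ ≤ M) :
    ‖expSum F ω P α‖ ≤ (2 * K + 1) ^ n * (|cj n| / P ^ n * M) := by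
  obtain ⟨hs, -, hsupp, hder⟩ := hω
  have hzero : ∀ (x : Fin n → ℤ) (i : Fin n), (K : ℤ) < |x i| → ω (fun i => (x i : ℝ) / P) = 0 := by
    intro x i hi
    by_contra hne
    have h1 : |(x i : ℝ) / P| ≤ c := hsupp (Function.mem_support.2 hne) i
    rw [abs_div, abs_of_pos hP, div_le_iff₀ hP] at h1
    have h2 : ((K : ℤ) : ℝ) < ((|x i| : ℤ) : ℝ) := Int.cast_lt.2 hi
    push_cast at h2
    have h3 : c * P ≤ |c| * P := mul_le_mul_of_nonneg_right (le_abs_self c) hP.le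
    linarith
  rw [expSum_eq_sum (a := fun _ => -(K : ℤ)) (b := fun _ => (K : ℤ))]
  · have := norm_sum_mul_ee_le (φ := fun x => α * (eval x F : ℤ)) hM
      (D := |cj n| / P ^ n) (by positivity) (List.finRange n) (List.nodup_finRange n)
      (fun x => ω fun i => (x i : ℝ) / P)
      (fun j _ x hx => hzero x j (by rw [hx, abs_of_nonneg (by positivity)]; omega))
      (fun j hj => absurd (List.mem_finRange j) hj)
      (abs_listDiff_le hs hP fun k x => (hder n k x).trans (le_abs_self _))
      (fun _ => -(K : ℤ)) (fun _ => (K : ℤ)) (fun _ => le_rfl) (fun _ => le_rfl)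
    rwa [List.length_finRange] at this
  · intro x hx
    rw [mem_zbox, not_forall] at hx
    obtain ⟨i, hi⟩ := hx
    exact hzero x i (by rw [lt_abs]; omega)

end QuarticWeyl
end

theorem mainTheorem8 (n : ℕ) (F : MvPolynomial (Fin n) ℤ)
    (hF : F.IsHomogeneous 4)
    (hirr : Irreducible (MvPolynomial.map (Int.castRingHom (AlgebraicClosure ℚ)) F))
    (c : ℝ) (cj : ℕ → ℝ) (ε : ℝ) (hε : 0 < ε) :
    ∃ C : ℝ, 0 < C ∧
      ∀ ω ∈ QuarticWeyl.weightClass n c cj ∪ {QuarticWeyl.boxWeight n},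
      ∀ (P : ℝ), 1 ≤ P →
      ∀ (a : ℤ) (q : ℕ) (z : ℝ), 1 ≤ q → IsCoprime a (q : ℤ) →
        z ≠ 0 → |z| ≤ 1 / (q : ℝ) ^ 2 →
        ‖QuarticWeyl.expSum F ω P ((a : ℝ) / (q : ℝ) + z)‖ ≤
          C * P ^ ((n : ℝ) + ε) *
            ((q : ℝ) * |z| + (q : ℝ)⁻¹ * |z|⁻¹ * (P ^ 4)⁻¹) ^
              (((n : ℝ) - (QuarticWeyl.sigma F : ℝ) - 1) / 24) := by
  have hc := abs_nonneg c
  obtain ⟨C, hC, h⟩ := QuarticWeyl.exists_norm_wsum_le hF (B := 2 * (|c| + 2)) (by linarith) hε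
  have hD : 0 ≤ (2 * (|c| + 2) + 1) ^ n * |cj n| := by positivity
  refine ⟨(2 * (|c| + 2) + 1) ^ n * |cj n| * C + C, by positivity, ?_⟩
  intro ω hω P hP a q z hq hcop hz hzq
  have hP0 : 0 < P := by linarith
  -- The extra `1` gives `K ≥ P`, so the same `K` serves the box weight; boxes of side `2K` explain
  -- `B = 2(|c| + 2)`.
  obtain ⟨K, hK⟩ : ∃ K : ℕ, K = ⌈(|c| + 1) * P⌉₊ := ⟨_, rfl⟩
  have hK1 : (|c| + 1) * P ≤ K := hK ▸ Nat.le_ceil _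
  have hK2 : (K : ℝ) ≤ (|c| + 2) * P := by
    have := (Nat.ceil_lt_add_one (show 0 ≤ (|c| + 1) * P by positivity)).le
    rw [← hK] at this
    nlinarith
  have hcP : 0 ≤ |c| * P := by positivity
  set E : ℝ := P ^ ((n : ℝ) + ε) *
    ((q : ℝ) * |z| + (q : ℝ)⁻¹ * |z|⁻¹ * (P ^ 4)⁻¹) ^
      (((n : ℝ) - (QuarticWeyl.sigma F : ℝ) - 1) / 24) with hE
  have hE0 : 0 ≤ E := by positivity
  have hM : ∀ b₁ b₂ : Fin n → ℤ, (∀ i, b₂ i - b₁ i ≤ 2 * (K : ℤ)) →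
      ‖QuarticWeyl.wsum (fun u => ((a : ℝ) / q + z) * (MvPolynomial.eval u F : ℤ)) b₁ b₂‖ ≤
        C * E := by
    intro b₁ b₂ hb
    rw [hE, ← mul_assoc]
    exact h P (2 * K) hP (by push_cast; linarith) (by push_cast; linarith) a q z hq hcop hz hzq
      b₁ b₂ (by push_cast; exact hb)
  rw [mul_assoc, ← hE, add_mul]
  rcases hω with hω | rfl
  · refine (QuarticWeyl.norm_expSum_le_of_mem_weightClass F hω hP0 (K := K) (by linarith)
      hM).trans ?_
    have hpow : (2 * (K : ℝ) + 1) ^ n ≤ ((2 * (|c| + 2) + 1) * P) ^ n :=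
      pow_le_pow_left₀ (by positivity) (by linarith) n
    calc (2 * (K : ℝ) + 1) ^ n * (|cj n| / P ^ n * (C * E))
        ≤ ((2 * (|c| + 2) + 1) * P) ^ n * (|cj n| / P ^ n * (C * E)) :=
          mul_le_mul_of_nonneg_right hpow (by positivity)
      _ = (2 * (|c| + 2) + 1) ^ n * |cj n| * C * E := by
          rw [mul_pow]; field_simp
      _ ≤ _ := le_add_of_nonneg_right (by positivity)
  · rw [QuarticWeyl.expSum_boxWeight F hP0]
    refine (hM _ _ fun i => ?_).trans (le_add_of_nonneg_left (by positivity))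
    have : ((⌊P⌋ : ℤ) : ℝ) ≤ ((K : ℤ) : ℝ) := by
      push_cast
      linarith [Int.floor_le P]
    have := Int.cast_le.1 this
    omega
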